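/- **Setting.** Let $T=[0,1]$, $U=[a,b]$ with $0<a\le b<\infty$, and let $g:U\times\mathbb R\to\mathbb R$ be such that every $g(u,\cdot)$ is $1$-periodic and integrable on $T$, with Fourier coefficients $g_m(u)=\int_T g(u,x)e^{-2\pi i m x}\,dx$, $m\in\mathbb Z$. For a sequence of sample sizes $n=N_nM_n\to\infty$ (write $M=M_n$, $N=N_n$; all of $u_l,d_l,\Sigma^{(l)}$ below may depend on $n$) one observes $$y(u_l,t_i)=\int_T g(u_l,t_i-x)f(x)\,dx+\xi_{li},\qquad l=1,\dots,M,\ i=1,\dots,N,\quad t_i=i/N,\ u_l\in U,$$ where the vectors $\xi^{(l)}=(\xi_{l1},\dots,\xi_{lN})^T$, $l=1,\dots,M$, are independent centred Gaussian vectors with covariance matrices $\Sigma^{(l)}$. (Where the integral does not exist its value is taken to be $0$; it exists for all $f\in L^2(T)$ if $g(u_l,\cdot)\in L^2(T)$.) For $V\subseteq L^2(T)$ let $R_n(V)=\inf_{\tilde f}\sup_{f\in V}\mathbb E\|\tilde f-f\|_{L^2(T)}^2$, the infimum being over all measurable $L^2(T)$-valued functions $\tilde f$ of the observations. Let $v\in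 C^\infty(\mathbb R)$ with $v(x)=0$ for $x\le0$, $v(x)=1$ for $x\ge1$ and $v(x)+v(1-x)=1$, and let $\varphi^*,\psi^*$ be the Meyer scaling function and wavelet associated with $v$, that is, the inverse Fourier transforms ($w(x)=\int \hat w(\xi)e^{2\pi i x\xi}d\xi$) of $$\hat\varphi^*(\xi)=\cos\!\big(\tfrac\pi2v(3|\xi|-1)\big),\qquad \hat\psi^*(\xi)=e^{-i\pi\xi}\sin\!\big(\tfrac\pi2v(3|\xi|-1)\big)\cos\!\big(\tfrac\pi2v(\tfrac32|\xi|-1)\big).$$ Put $\varphi_{jk}(x)=\sum_{i\in\mathbb Z}2^{j/2}\varphi^*(2^j(x+i)-k)$, $\psi_{jk}(x)=\sum_{i\in\mathbb Z}2^{j/2}\psi^*(2^j(x+i)-k)$ for $j\ge0$, $0\le k<2^j$, and $a_{jk}=\langle f,\varphi_{jk}\rangle$, $b_{jk}=\langle f,\psi_{jk}\rangle$. Let $j_0\ge0$ be a fixed integer, $1\le p,q\le\infty$, $A>0$, $s>\max(0,1/p-1/2)$, and put $s'=s+\frac12-\frac1p$, $p'=\min\{p,2\}$, $s^*=s+\frac12-\frac1{p'}$.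 The Besov ball $B^s_{p,q}(A)$ is the set of $f\in L^2(T)$ with $$\Big(\sum_{k=0}^{2^{j_0}-1}|a_{j_0k}|^p\Big)^{1/p}+\Big(\sum_{j\ge j_0}2^{js'q}\Big(\sum_{k=0}^{2^j-1}|b_{jk}|^p\Big)^{q/p}\Big)^{1/q}\le A,$$ with suprema in place of sums when $p=\infty$ or $q=\infty$. **Assumption A1.** There are $0\le d_l<1/2$ and constants $0<K_1\le K_2<\infty$, independent of $l$ and $n$, such that $K_1N^{2d_l}\le\lambda_{\min}(\Sigma^{(l)})\le\lambda_{\max}(\Sigma^{(l)})\le K_2N^{2d_l}$ for all $l$. **Assumption A2.** Let $\tau_1(m,n)=M^{-1}\sum_{l=1}^MN^{-2d_l}|g_m(u_l)|^2$. There are constants $\nu_1,\nu_2,\lambda_1,\lambda_2\in\mathbb R$, $\alpha_1,\alpha_2\ge0$, $K_3,K_4,\beta>0$, an integer $m_0\ge2$ (all independent of $m$ and $n$) and numbers $\varepsilon_n>0$ such that for all $n$ and all integers $m$ with $|m|\ge m_0$ $$K_3\varepsilon_n|m|^{-2\nu_1}(\ln|m|)^{-\lambda_1}e^{-\alpha_1|m|^\beta}\le\tau_1(m,n)\le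 K_4\varepsilon_n|m|^{-2\nu_2}(\ln|m|)^{-\lambda_2}e^{-\alpha_2|m|^\beta},$$ where either $\alpha_1\alpha_2\ne0$, or $\alpha_1=\alpha_2=0$ and $\nu_1=\nu_2=:\nu>0$; moreover $n^*:=n\varepsilon_n\to\infty$. **Theorem.** Under these assumptions there is a constant $C>0$, independent of $n$, such that for all sufficiently large $n$ $$R_n(B^s_{p,q}(A))\ge\begin{cases}C\,(n^*)^{-\frac{2s}{2s+2\nu+1}}(\ln n^*)^{\frac{2s\lambda_2}{2s+2\nu+1}},&\alpha_1=\alpha_2=0,\ \nu(2-p)<ps^*,\\[4pt] C\left(\frac{\ln n^*}{n^*}\right)^{\frac{2s^*}{2s^*+2\nu}}(\ln n^*)^{\frac{2s^*\lambda_2}{2s^*+2\nu}},&\alpha_1=\alpha_2=0,\ \nu(2-p)\ge ps^*,\\[4pt] C\,(\ln n^*)^{-\frac{2s^*}{\beta}},&\alpha_1\alpha_2\ne0,\end{cases}$$ where the conditions in the first two lines are read as $\nu(2/p-1)<s^*$ and $\nu(2/p-1)\ge s^*$, so that $p=\infty$ belongs to the first line. -/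

import Mathlib

open MeasureTheory ProbabilityTheory Filter
open scoped ENNReal FourierTransform ContDiff

noncomputable section

namespace MultichannelDeconvolution

/-! ### The Meyer wavelets and their periodization -/

/-- An auxiliary function of a Meyer wavelet: a smooth transition from `0` (on `x ≤ 0`) to `1`
(on `x ≥ 1`) with `v x + v (1 - x) = 1`. -/
structure IsMeyerAux (v : ℝ → ℝ) : Prop where
  smooth : ContDiff ℝ ∞ v
  eq_zero : ∀ x, x ≤ 0 → v x = 0
  eq_one : ∀ x, 1 ≤ x → v x = 1
  add_symm : ∀ x, v x + v (1 - x) = 1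

/-- Fourier transform of the Meyer scaling function, in the frequency variable `ξ = ω / (2π)`. -/
def meyerScalingHat (v : ℝ → ℝ) (ξ : ℝ) : ℂ :=
  (Real.cos (Real.pi / 2 * v (3 * |ξ| - 1)) : ℝ)

/-- Fourier transform of the Meyer mother wavelet, in the variable `ξ = ω / (2π)`. The product is
`sin (π/2 v(3|ξ|-1))` for `1/3 ≤ |ξ| ≤ 2/3`, where the second factor is `1`;
`cos (π/2 v(3|ξ|/2-1))` for `2/3 ≤ |ξ| ≤ 4/3`, where the first factor is `1`; and `0` elsewhere. -/
def meyerWaveletHat (v : ℝ → ℝ) (ξ : ℝ) : ℂ :=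
  Complex.exp (-(Real.pi * ξ * Complex.I)) *
    ((Real.sin (Real.pi / 2 * v (3 * |ξ| - 1)) *
      Real.cos (Real.pi / 2 * v (3 * |ξ| / 2 - 1)) : ℝ) : ℂ)

/-- The (real-valued) Meyer scaling function on the line. -/
def meyerScaling (v : ℝ → ℝ) (x : ℝ) : ℝ := (𝓕⁻ (meyerScalingHat v) x).re

/-- The (real-valued) Meyer mother wavelet on the line. -/
def meyerWavelet (v : ℝ → ℝ) (x : ℝ) : ℝ := (𝓕⁻ (meyerWaveletHat v) x).re

/-- `∑_{i ∈ ℤ} 2^{j/2} w (2^j (x + i) - k)`: dilation, translation and periodization of `w`. -/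
def periodized (w : ℝ → ℝ) (j k : ℕ) (x : ℝ) : ℝ :=
  ∑' i : ℤ, (2 : ℝ) ^ ((j : ℝ) / 2) * w (2 ^ j * (x + i) - k)

/-! ### The space `L²(T)`, `T = [0, 1]`, and Besov balls -/

/-- Lebesgue measure on `T = [0, 1]`. -/
def volT : Measure ℝ := volume.restrict (Set.Icc 0 1)

/-- The real Hilbert space `L²(T)`. -/
abbrev L2T : Type := Lp ℝ 2 volT

/-- Scaling coefficient `a_{jk} = ⟨f, φ_{jk}⟩`. -/
def scalingCoeff (v : ℝ → ℝ) (f : L2T) (j k : ℕ) : ℝ :=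
  ∫ x, f x * periodized (meyerScaling v) j k x ∂volT

/-- Wavelet coefficient `b_{jk} = ⟨f, ψ_{jk}⟩`. -/
def waveletCoeff (v : ℝ → ℝ) (f : L2T) (j k : ℕ) : ℝ :=
  ∫ x, f x * periodized (meyerWavelet v) j k x ∂volT

/-- The `ℓ^p` norm, `p ∈ [1, ∞]`, of a family of numbers of `[0, ∞]`. -/
def ellNorm {ι : Type} (p : ℝ≥0∞) (c : ι → ℝ≥0∞) : ℝ≥0∞ :=
  if p = ⊤ then ⨆ i, c i else (∑' i, c i ^ p.toReal) ^ (1 / p.toReal)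

/-- `s' = s + 1/2 - 1/p`. -/
def sPrime (s : ℝ) (p : ℝ≥0∞) : ℝ := s + 1 / 2 - (p⁻¹).toReal

/-- `s* = s + 1/2 - 1/p'` with `p' = min {p, 2}`. -/
def sStar (s : ℝ) (p : ℝ≥0∞) : ℝ := s + 1 / 2 - ((min p 2)⁻¹).toReal

/-- The Besov ball `B^s_{p,q}(A)`, in terms of the periodized Meyer wavelet coefficients with
coarsest resolution level `j₀`. -/
def besovBall (v : ℝ → ℝ) (j₀ : ℕ) (s : ℝ) (p q : ℝ≥0∞) (A : ℝ) : Set L2T :=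
  {f | ellNorm p (fun k : Fin (2 ^ j₀) => ‖scalingCoeff v f j₀ k‖ₑ) +
      ellNorm q (fun j : {j : ℕ // j₀ ≤ j} =>
        ENNReal.ofReal ((2 : ℝ) ^ ((j : ℝ) * sPrime s p)) *
          ellNorm p (fun k : Fin (2 ^ (j : ℕ)) => ‖waveletCoeff v f j k‖ₑ))
      ≤ ENNReal.ofReal A}

/-! ### The multichannel deconvolution model -/

/-- Functional Fourier coefficient `∫_T w(x) e^{-2π i m x} dx`. -/
def fourierCoefT (w : ℝ → ℝ) (m : ℤ) : ℂ :=
  ∫ x, (w x : ℂ) * Complex.exp (-(2 * Real.pi * m * x * Complex.I)) ∂volT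

/-- `h(u, ·)` at `t`: the convolution `∫_T g(u, t - x) f(x) dx`, for `gu = g(u, ·)`. The integral
exists for all `f` and `t` when `gu` is square integrable on `T`, and for all `t` and bounded `f`
when `gu` is integrable; where it does not exist, its value is `0` by convention. -/
def blurred (gu : ℝ → ℝ) (f : L2T) (t : ℝ) : ℝ := ∫ x, gu (t - x) * f x ∂volT

/-- The vector `(h(u, t_1), …, h(u, t_N))`, with `t_i = i / N`, `i = 1, …, N`. -/
def blurredVec (gu : ℝ → ℝ) (f : L2T) (N : ℕ) : EuclideanSpace ℝ (Fin N) :=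
  WithLp.toLp 2 fun i => blurred gu f (((i : ℝ) + 1) / N)

/-- Space of the observations `y(u_l, t_i)`, `l = 1, …, M`, `i = 1, …, N`. -/
abbrev Obs (M N : ℕ) : Type := Fin M → EuclideanSpace ℝ (Fin N)

/-- Law of the observations `y(u_l, t_i) = h(u_l, t_i) + ξ_{li}`: the channels `l` are independent,
and `ξ^{(l)}` is a centred Gaussian vector with covariance matrix `S l`. -/
def obsLaw (g : ℝ → ℝ → ℝ) {M N : ℕ} (u : Fin M → ℝ) (S : Fin M → Matrix (Fin N) (Fin N) ℝ)
    (f : L2T) : Measure (Obs M N) :=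
  Measure.pi fun l => multivariateGaussian (blurredVec (g (u l)) f N) (S l)

/-- The minimax `L²`-risk `inf_{f̃} sup_{f ∈ V} E ‖f̃ - f‖²`; the infimum is over all (measurable)
estimators based on the observations. -/
def minimaxRisk (g : ℝ → ℝ → ℝ) {M N : ℕ} (u : Fin M → ℝ)
    (S : Fin M → Matrix (Fin N) (Fin N) ℝ) (V : Set L2T) : ℝ≥0∞ :=
  ⨅ (est : Obs M N → L2T) (_ : StronglyMeasurable est),
    ⨆ f ∈ V, ∫⁻ y, ‖est y - f‖ₑ ^ 2 ∂(obsLaw g u S f)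

/-- `τ_1(m, n) = M⁻¹ ∑_l N^{-2 d_l} |g_m(u_l)|²`. -/
def tau1 (g : ℝ → ℝ → ℝ) {M : ℕ} (N : ℕ) (u d : Fin M → ℝ) (m : ℤ) : ℝ :=
  (M : ℝ)⁻¹ * ∑ l, (N : ℝ) ^ (-2 * d l) * ‖fourierCoefT (g (u l)) m‖ ^ 2

/-- The bounding function `ε |m|^{-2ν} (ln |m|)^{-λ} e^{-α |m|^β}`. -/
def tauBound (ε ν lam α β : ℝ) (m : ℤ) : ℝ :=
  ε * |(m : ℝ)| ^ (-2 * ν) * Real.log |(m : ℝ)| ^ (-lam) * Real.exp (-α * |(m : ℝ)| ^ β)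

end MultichannelDeconvolution

end

/-! The hard functions are combinations of periodized Meyer wavelets of one level j, scaled to fit
in the Besov ball. Dense case: the cube γ Σ_k ±ψ_jk with γ = A 2^(-j(s+1/2)). Assouad's argument
(`exists_le_lintegral_of_hypercube`) shows that a fixed share of the 2^j signs is missed, at a risk
of order 2^j γ² = A² 2^(-2js). Sparse case: single spikes γ ψ_jk with γ = A 2^(-js'), too numerous
to be told apart (`exists_le_lintegral_of_separated`), at a risk of order A² 2^(-2js').

Closeness of two laws is measured by the second moment of their likelihood ratio. For a Gaussian
shift this is the exponential of the squared length of the shift, so changing the coefficient of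
ψ_jk by x costs at most exp(x² E_jk / K₁), where E_jk is `waveletEnergy`. Only the sum of E_jk over
k has to be controlled. For fixed t the numbers (g ∗ ψ_jk)(t) are inner products of the vector (g_m
e^{2πimt})_m with the orthonormal vectors of Fourier coefficients of the ψ_jk, so Bessel's
inequality bounds their squares by Σ |g_m|² over the frequency band of level j
(`sum_sq_blurred_waveletL2_le`). This holds pointwise, so sampling on a grid causes no aliasing.
Summation over points and channels gives Σ_k E_jk ≤ n Σ_m τ₁(m, n), which is at most a constant
times n* 2^(j(1-2ν₂)) j^(-λ₂) exp(-c 2^(jβ)).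

The cube requires γ² Σ_k E_jk to be at most of order 2^j. The spikes may use the logarithm of their
number and require only order j 2^j, whence the additional logarithm of the sparse rate. The level
is taken nearly as small as these conditions permit: 2^j is a power of n*, up to logarithms, when c
= 0, and of order (ln n*)^(1/β) when c > 0.

The orthogonality relations come from Poisson summation, which turns the wavelets into trigonometric
polynomials, and from folding the resulting sums modulo 2^j. -/

namespace MultichannelDeconvolution

/-! ### Second moments of likelihood ratios -/

/-- `Q` has a density with respect to `P` whose second moment is at most `B`. -/
def HasDensitySqLE {Ω : Type*} [MeasurableSpace Ω] (P Q : Measure Ω) (B : ℝ≥0∞) : Prop :=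
  ∃ L : Ω → ℝ≥0∞, Measurable L ∧ Q = P.withDensity L ∧ ∫⁻ x, L x ^ 2 ∂P ≤ B

lemma HasDensitySqLE.mono {Ω : Type*} [MeasurableSpace Ω] {P Q : Measure Ω} {B B' : ℝ≥0∞}
    (h : HasDensitySqLE P Q B) (hB : B ≤ B') : HasDensitySqLE P Q B' := by
  obtain ⟨L, h1, h2, h3⟩ := h
  exact ⟨L, h1, h2, h3.trans hB⟩

/-- Cauchy–Schwarz for the density against the indicator of `E`. The lower bounds for the risk use
the laws only through this inequality. -/
lemma HasDensitySqLE.sq_measure_le {Ω : Type*} [MeasurableSpace Ω] {P Q : Measure Ω} {B : ℝ≥0∞}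
    (h : HasDensitySqLE P Q B) {E : Set Ω} (hE : MeasurableSet E) : Q E ^ 2 ≤ B * P E := by
  obtain ⟨L, hL, rfl, hB⟩ := h
  have h1 := ENNReal.lintegral_mul_le_Lp_mul_Lq P Real.HolderConjugate.two_two hL.aemeasurable
    ((measurable_const (a := (1 : ℝ≥0∞))).indicator hE).aemeasurable
  have h2 : ∫⁻ a, (L * E.indicator fun _ => (1 : ℝ≥0∞)) a ∂P = P.withDensity L E := by
    rw [withDensity_apply _ hE, ← lintegral_indicator hE]
    refine lintegral_congr fun x => ?_
    by_cases hx : x ∈ E <;> simp [hx]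
  have h3 : ∫⁻ a, (E.indicator (fun _ => (1 : ℝ≥0∞)) a) ^ (2 : ℝ) ∂P = P E := by
    rw [← lintegral_indicator_one hE]
    refine lintegral_congr fun x => ?_
    by_cases hx : x ∈ E <;> simp [hx]
  rw [h2, h3] at h1
  calc P.withDensity L E ^ 2
      ≤ ((∫⁻ a, L a ^ (2 : ℝ) ∂P) ^ (1 / 2 : ℝ) * P E ^ (1 / 2 : ℝ)) ^ 2 := by gcongr
    _ = (∫⁻ a, L a ^ (2 : ℝ) ∂P) * P E := by
        rw [mul_pow, ← ENNReal.rpow_natCast, ← ENNReal.rpow_natCast, ← ENNReal.rpow_mul,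
          ← ENNReal.rpow_mul]
        norm_num
    _ ≤ B * P E := by
        gcongr
        simpa using hB

lemma HasDensitySqLE.map_equiv {Ω Ω' : Type*} [MeasurableSpace Ω] [MeasurableSpace Ω']
    {P Q : Measure Ω} {B : ℝ≥0∞} (h : HasDensitySqLE P Q B) (e : Ω ≃ᵐ Ω') :
    HasDensitySqLE (P.map e) (Q.map e) B := by
  obtain ⟨L, hL, rfl, hB⟩ := h
  refine ⟨L ∘ e.symm, hL.comp e.symm.measurable, ?_, ?_⟩
  · ext E hE
    rw [e.map_apply, withDensity_apply _ (e.measurable hE), withDensity_apply _ hE,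
      ← lintegral_indicator hE, lintegral_map_equiv, ← lintegral_indicator (e.measurable hE)]
    refine lintegral_congr fun x => ?_
    by_cases hx : e x ∈ E <;> simp [hx]
  · rw [lintegral_map_equiv]
    simpa using hB

lemma lintegral_pi_prod {ι : Type*} [Fintype ι] {Ω : ι → Type*} [∀ i, MeasurableSpace (Ω i)]
    (P : ∀ i, Measure (Ω i)) [∀ i, IsProbabilityMeasure (P i)] {L : ∀ i, Ω i → ℝ≥0∞}
    (hL : ∀ i, Measurable (L i)) :
    ∫⁻ x, ∏ i, L i (x i) ∂(Measure.pi P) = ∏ i, ∫⁻ y, L i y ∂(P i) := by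
  refine (lintegral_prod_eq_prod_lintegral_of_indepFun Finset.univ (fun i (x : ∀ i, Ω i) => L i (x i))
    (iIndepFun_pi fun i => (hL i).aemeasurable)
    fun i => (hL i).comp (measurable_pi_apply i)).trans ?_
  refine Finset.prod_congr rfl fun i _ => ?_
  exact (measurePreserving_eval P i).lintegral_comp (hL i)

/-- The product of the coordinate densities is a density, as testing on boxes shows, and its second
moment factorises by independence. -/
lemma HasDensitySqLE.pi {ι : Type*} [Fintype ι] {Ω : ι → Type*} [∀ i, MeasurableSpace (Ω i)]
    {P Q : ∀ i, Measure (Ω i)} [∀ i, IsProbabilityMeasure (P i)] [∀ i, IsProbabilityMeasure (Q i)]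
    {B : ι → ℝ≥0∞} (h : ∀ i, HasDensitySqLE (P i) (Q i) (B i)) :
    HasDensitySqLE (Measure.pi P) (Measure.pi Q) (∏ i, B i) := by
  choose L hL hQ hB using h
  refine ⟨fun x => ∏ i, L i (x i), by fun_prop, ?_, ?_⟩
  · refine Measure.pi_eq fun s hs => ?_
    rw [withDensity_apply _ (MeasurableSet.univ_pi hs),
      ← lintegral_indicator (MeasurableSet.univ_pi hs)]
    have : ∀ x : (∀ i, Ω i), (Set.univ.pi s).indicator (fun x => ∏ i, L i (x i)) x
        = ∏ i, (s i).indicator (L i) (x i) := by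
      intro x
      by_cases hx : x ∈ Set.univ.pi s
      · rw [Set.indicator_of_mem hx]
        refine Finset.prod_congr rfl fun i _ => ?_
        rw [Set.indicator_of_mem (hx i (Set.mem_univ i))]
      · rw [Set.indicator_of_notMem hx]
        simp only [Set.mem_pi, Set.mem_univ, true_implies, not_forall] at hx
        obtain ⟨i, hi⟩ := hx
        exact (Finset.prod_eq_zero (Finset.mem_univ i) (Set.indicator_of_notMem hi _)).symm
    simp_rw [this]
    rw [lintegral_pi_prod P fun i => (hL i).indicator (hs i)]
    refine Finset.prod_congr rfl fun i _ => ?_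
    rw [lintegral_indicator (hs i), hQ i, withDensity_apply _ (hs i)]
  · simp_rw [← Finset.prod_pow]
    rw [lintegral_pi_prod P fun i => (hL i).pow_const 2]
    exact Finset.prod_le_prod' fun i _ => hB i

lemma lintegral_exp_mul_gaussianReal (t : ℝ) :
    ∫⁻ x, ENNReal.ofReal (Real.exp (t * x)) ∂(gaussianReal 0 1)
      = ENNReal.ofReal (Real.exp (t ^ 2 / 2)) := by
  rw [← ofReal_integral_eq_lintegral_ofReal (integrable_exp_mul_gaussianReal t)
    (ae_of_all _ fun _ => (Real.exp_pos _).le)]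
  have := mgf_gaussianReal (p := gaussianReal 0 1) (X := id) (μ := 0) (v := 1) (by simp) t
  simp only [mgf, id] at this
  rw [this]; simp

/-- The likelihood ratio is exp(hx - h²/2); its second moment is exp(-h²) times the exponential
moment exp(2h²). -/
lemma hasDensitySqLE_gaussianReal (h : ℝ) :
    HasDensitySqLE (gaussianReal 0 1) (gaussianReal h 1) (ENNReal.ofReal (Real.exp (h ^ 2))) := by
  refine ⟨fun x => ENNReal.ofReal (Real.exp (h * x - h ^ 2 / 2)), by fun_prop, ?_, ?_⟩
  · rw [gaussianReal_of_var_ne_zero _ one_ne_zero, gaussianReal_of_var_ne_zero _ one_ne_zero,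
      ← withDensity_mul _ (measurable_gaussianPDF _ _) (by fun_prop)]
    congr 1
    ext x
    simp only [Pi.mul_apply, gaussianPDF, gaussianPDFReal]
    rw [← ENNReal.ofReal_mul (by positivity), mul_assoc _ (Real.exp (-(x - 0) ^ 2 / _)),
      ← Real.exp_add]
    congr 3
    simp; ring
  · have : ∀ x : ℝ, ENNReal.ofReal (Real.exp (h * x - h ^ 2 / 2)) ^ 2
        = ENNReal.ofReal (Real.exp (-h ^ 2)) * ENNReal.ofReal (Real.exp (2 * h * x)) := by
      intro x
      rw [← ENNReal.ofReal_pow (Real.exp_pos _).le, ← ENNReal.ofReal_mul (Real.exp_pos _).le,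
        ← Real.exp_nat_mul, ← Real.exp_add]
      congr 2; push_cast; ring
    simp_rw [this]
    rw [lintegral_const_mul _ (by fun_prop), lintegral_exp_mul_gaussianReal,
      ← ENNReal.ofReal_mul (Real.exp_pos _).le, ← Real.exp_add]
    apply le_of_eq; congr 2; ring

lemma hasDensitySqLE_stdGaussian {ι : Type*} [Fintype ι] (h : EuclideanSpace ℝ ι) :
    HasDensitySqLE (stdGaussian (EuclideanSpace ℝ ι))
      ((stdGaussian (EuclideanSpace ℝ ι)).map (fun x => h + x))
      (ENNReal.ofReal (Real.exp (‖h‖ ^ 2))) := by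
  have h1 := (HasDensitySqLE.pi fun i : ι => hasDensitySqLE_gaussianReal (h i)).map_equiv
    (MeasurableEquiv.toLp 2 (ι → ℝ))
  rw [← ENNReal.ofReal_prod_of_nonneg fun i _ => (Real.exp_pos _).le, ← Real.exp_sum,
    ← EuclideanSpace.real_norm_sq_eq] at h1
  convert! h1 using 1
  · exact map_pi_eq_stdGaussian.symm
  · have h2 : (Measure.pi fun i : ι => gaussianReal (h i) 1)
        = (Measure.pi fun _ : ι => gaussianReal 0 1).map (fun x i => h i + x i) := by
      rw [Measure.pi_map_pi (μ := fun _ => gaussianReal 0 1) (f := fun i x => h i + x)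
        fun i => by fun_prop]
      congr 1; ext1 i
      rw [gaussianReal_map_const_add]; simp
    rw [h2, ← map_pi_eq_stdGaussian, Measure.map_map (by fun_prop) (by fun_prop),
      Measure.map_map (by fun_prop) (by fun_prop)]
    rfl

/-! ### Gaussian vectors with a general covariance matrix -/

section Multivariate

variable {ι : Type*} [Fintype ι] [DecidableEq ι]

open scoped MatrixOrder in
-- The left side is ⟨x, S x⟩, expanded in an eigenbasis of `S`. It turns a lower bound on
-- eigenvalues into coercivity of the square root.
lemma norm_sq_toEuclideanCLM_sqrt {S : Matrix ι ι ℝ} (hS : S.PosSemidef) (x : EuclideanSpace ℝ ι) :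
    ‖Matrix.toEuclideanCLM (𝕜 := ℝ) (CFC.sqrt S) x‖ ^ 2
      = ∑ i, hS.isHermitian.eigenvalues i * inner ℝ (hS.isHermitian.eigenvectorBasis i) x ^ 2 := by
  set A := Matrix.toEuclideanCLM (𝕜 := ℝ) (CFC.sqrt S) with hA
  have hAA : A * A = Matrix.toEuclideanCLM (𝕜 := ℝ) S := by
    rw [hA, ← map_mul, CFC.sqrt_mul_sqrt_self _ hS.nonneg]
  have hsa : IsSelfAdjoint A := (CFC.sqrt_nonneg S).isSelfAdjoint.map _
  have h1 : ∀ y z, inner ℝ (A y) z = inner ℝ y (A z) := fun y z =>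
    (ContinuousLinearMap.isSelfAdjoint_iff_isSymmetric.1 hsa) y z
  set b := hS.isHermitian.eigenvectorBasis with hb
  have h2 : ∀ i, Matrix.toEuclideanCLM (𝕜 := ℝ) S (b i) = hS.isHermitian.eigenvalues i • b i := by
    intro i
    apply (WithLp.ofLp_injective 2)
    exact hS.isHermitian.mulVec_eigenvectorBasis i
  have h3 : ∀ y z, inner ℝ (Matrix.toEuclideanCLM (𝕜 := ℝ) S y) z
      = inner ℝ y (Matrix.toEuclideanCLM (𝕜 := ℝ) S z) := by
    intro y z
    rw [← hAA]
    simp only [mul_apply_eq_comp, h1]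
  rw [← real_inner_self_eq_norm_sq, h1, ← mul_apply_eq_comp, hAA,
    ← b.sum_inner_mul_inner]
  refine Finset.sum_congr rfl fun i _ => ?_
  rw [← h3, h2, inner_smul_left, real_inner_comm]
  simp; ring

open scoped MatrixOrder in
-- Under the bijection x ↦ μ + S^(1/2) x the two laws are images of the standard Gaussian and of its
-- shift by h = S^(-1/2)(μ' - μ). A bijection preserves likelihood ratios, and ‖h‖² ≤ κ⁻¹ ‖μ' - μ‖².
lemma hasDensitySqLE_multivariateGaussian {S : Matrix ι ι ℝ} (hS : S.PosSemidef) {κ : ℝ}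
    (hκ : 0 < κ) (hSκ : ∀ i, κ ≤ hS.isHermitian.eigenvalues i) (μ μ' : EuclideanSpace ℝ ι) :
    HasDensitySqLE (multivariateGaussian μ S) (multivariateGaussian μ' S)
      (ENNReal.ofReal (Real.exp (κ⁻¹ * ‖μ' - μ‖ ^ 2))) := by
  set A := Matrix.toEuclideanCLM (𝕜 := ℝ) (CFC.sqrt S) with hA
  have hlow : ∀ x, κ * ‖x‖ ^ 2 ≤ ‖A x‖ ^ 2 := by
    intro x
    rw [norm_sq_toEuclideanCLM_sqrt hS, ← hS.isHermitian.eigenvectorBasis.sum_sq_inner_right x,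
      Finset.mul_sum]
    exact Finset.sum_le_sum fun i _ => mul_le_mul_of_nonneg_right (hSκ i) (sq_nonneg _)
  have hinj : Function.Injective A := by
    rw [injective_iff_map_eq_zero]
    intro x hx
    have := hlow x
    rw [hx] at this
    have h0 : ‖x‖ ^ 2 ≤ 0 := by
      by_contra hc
      push Not at hc
      have := mul_pos hκ hc
      simp at *
      linarith
    simpa using le_antisymm h0 (sq_nonneg _)
  let T : EuclideanSpace ℝ ι ≃L[ℝ] EuclideanSpace ℝ ι :=
    (LinearEquiv.ofInjectiveEndo A.toLinearMap hinj).toContinuousLinearEquiv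
  have hT : ∀ x, T x = A x := fun x => rfl
  let e : EuclideanSpace ℝ ι ≃ᵐ EuclideanSpace ℝ ι :=
    T.toHomeomorph.toMeasurableEquiv.trans (Homeomorph.addLeft μ).toMeasurableEquiv
  have he : ∀ x, e x = μ + A x := fun x => rfl
  set h := T.symm (μ' - μ) with hh
  have hAh : A h = μ' - μ := by rw [← hT, hh, T.apply_symm_apply]
  have h1 := (hasDensitySqLE_stdGaussian h).map_equiv e
  rw [Measure.map_map (by fun_prop) (by fun_prop)] at h1
  have h2 : (⇑e ∘ fun x => h + x) = fun x => μ' + A x := by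
    ext1 x
    simp only [Function.comp, he, map_add, hAh]
    abel
  rw [h2] at h1
  refine HasDensitySqLE.mono h1 ?_
  apply ENNReal.ofReal_le_ofReal
  apply Real.exp_le_exp.2
  rw [← hAh, inv_mul_eq_div, le_div_iff₀ hκ, mul_comm]
  exact hlow h

end Multivariate

lemma hasDensitySqLE_pi_multivariateGaussian {M N : ℕ} {S : Fin M → Matrix (Fin N) (Fin N) ℝ}
    (hS : ∀ l, (S l).PosSemidef) {κ : Fin M → ℝ} (hκ : ∀ l, 0 < κ l)
    (hSκ : ∀ l i, κ l ≤ (hS l).isHermitian.eigenvalues i)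
    (μ μ' : Fin M → EuclideanSpace ℝ (Fin N)) :
    HasDensitySqLE (Measure.pi fun l => multivariateGaussian (μ l) (S l))
      (Measure.pi fun l => multivariateGaussian (μ' l) (S l))
      (ENNReal.ofReal (Real.exp (∑ l, (κ l)⁻¹ * ‖μ' l - μ l‖ ^ 2))) := by
  rw [Real.exp_sum, ENNReal.ofReal_prod_of_nonneg fun i _ => (Real.exp_pos _).le]
  exact HasDensitySqLE.pi fun l =>
    hasDensitySqLE_multivariateGaussian (hS l) (hκ l) (hSκ l) (μ l) (μ' l)

end MultichannelDeconvolution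

namespace MultichannelDeconvolution

/-! ### Lower bounds for the maximal risk -/

section LowerBounds

variable {Ω : Type*} [MeasurableSpace Ω]

/-- The two errors of a test cannot both be small: if `Q E` is at least 1/2 the hypothesis forces `P
E` to be at least 1/(4B), and otherwise `Q Eᶜ` exceeds 1/2, which is larger since `B` is at least 1.
-/
lemma one_div_le_measureReal_add {P Q : Measure Ω} [IsProbabilityMeasure P]
    [IsProbabilityMeasure Q] {B : ℝ} (hB : 1 ≤ B) {E : Set Ω} (hE : MeasurableSet E)
    (h : Q E ^ 2 ≤ ENNReal.ofReal B * P E) : 1 / (4 * B) ≤ P.real E + Q.real Eᶜ := by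
  have h1 : Q.real E ^ 2 ≤ B * P.real E := by
    have := ENNReal.toReal_mono (by finiteness) h
    rwa [ENNReal.toReal_pow, ENNReal.toReal_mul, ENNReal.toReal_ofReal (by linarith)] at this
  have h2 : Q.real Eᶜ = 1 - Q.real E := probReal_compl_eq_one_sub hE
  have h3 : 0 ≤ P.real E := measureReal_nonneg
  have h4 : Q.real E ≤ 1 := measureReal_le_one
  have hB4 : 1 / (4 * B) ≤ 1 / 4 := by
    apply one_div_le_one_div_of_le <;> linarith
  by_contra hc
  push Not at hc
  have h5 : 1 / 2 ≤ Q.real E := by linarith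
  have h6 : 1 / 4 ≤ B * P.real E := by nlinarith
  have h7 : 1 / (4 * B) ≤ P.real E := by
    rw [div_le_iff₀ (by linarith)]; linarith
  linarith

/-- The sign attached to a vertex of the hypercube. -/
def boolSign (b : Bool) : ℝ := if b then 1 else -1

lemma boolSign_sq (b : Bool) : boolSign b ^ 2 = 1 := by cases b <;> simp [boolSign]

/-- Assouad's lemma: a lower bound over a hypercube spanned by an orthonormal family. -/
lemma exists_le_lintegral_of_hypercube {H : Type*} [NormedAddCommGroup H]
    [InnerProductSpace ℝ H] {K : Type*} [Fintype K] [DecidableEq K] {w : K → H} (hw : Orthonormal ℝ w)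
    (P : (K → Bool) → Measure Ω) [∀ θ, IsProbabilityMeasure (P θ)] {B : K → ℝ}
    (hB : ∀ k, 1 ≤ B k)
    (hP : ∀ θ k, ∀ E, MeasurableSet E →
      P (Function.update θ k (!θ k)) E ^ 2 ≤ ENNReal.ofReal (B k) * P θ E)
    {γ : ℝ} (hγ : 0 ≤ γ) {est : Ω → H} (hest : StronglyMeasurable est) :
    ∃ θ, ENNReal.ofReal (γ ^ 2 * ∑ k, 1 / (8 * B k)) ≤
      ∫⁻ y, ‖est y - ∑ k, (γ * boolSign (θ k)) • w k‖ₑ ^ 2 ∂(P θ) := by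
  -- The event that the sign of the k-th coefficient of the estimator is wrong for θ. A zero
  -- coefficient counts as positive, so that the events for opposite signs are exactly
  -- complementary.
  let Wr : (K → Bool) → K → Set Ω := fun θ k =>
    {y | if θ k then inner ℝ (w k) (est y) < 0 else 0 ≤ inner ℝ (w k) (est y)}
  have hmeas : ∀ k, Measurable fun y => inner ℝ (w k) (est y) := fun k =>
    (stronglyMeasurable_const.inner hest).measurable
  have hWr : ∀ θ k, MeasurableSet (Wr θ k) := by
    intro θ k
    by_cases h : θ k
    · simpa [Wr, h] using measurableSet_lt (hmeas k) measurable_const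
    · simpa [Wr, h] using measurableSet_le measurable_const (hmeas k)
  have hflip : ∀ θ k, Wr (Function.update θ k (!θ k)) k = (Wr θ k)ᶜ := by
    intro θ k
    ext y
    by_cases h : θ k <;> simp [Wr, h]
  -- Each wrong sign costs at least γ² in its own coordinate, and Bessel's inequality adds these
  -- costs.
  have hpt : ∀ θ y, ∑ k, (Wr θ k).indicator (fun _ => ENNReal.ofReal (γ ^ 2)) y ≤
      ‖est y - ∑ k, (γ * boolSign (θ k)) • w k‖ₑ ^ 2 := by
    intro θ y
    have h1 := hw.sum_inner_products_le (est y - ∑ k, (γ * boolSign (θ k)) • w k)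
      (s := Finset.univ)
    have h2 : ∀ k, inner ℝ (w k) (est y - ∑ k, (γ * boolSign (θ k)) • w k)
        = inner ℝ (w k) (est y) - γ * boolSign (θ k) := by
      intro k
      rw [inner_sub_right, hw.inner_right_fintype]
    have h3 : ∀ k, (Wr θ k).indicator (fun _ => ENNReal.ofReal (γ ^ 2)) y ≤
        ENNReal.ofReal (‖inner ℝ (w k) (est y - ∑ k, (γ * boolSign (θ k)) • w k)‖ ^ 2) := by
      intro k
      by_cases hy : y ∈ Wr θ k
      · rw [Set.indicator_of_mem hy, h2, Real.norm_eq_abs, sq_abs]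
        apply ENNReal.ofReal_le_ofReal
        by_cases h : θ k
        · have hy' : inner ℝ (w k) (est y) < 0 := by simpa [Wr, h] using hy
          simp only [h, boolSign, if_true]
          nlinarith
        · have hy' : 0 ≤ inner ℝ (w k) (est y) := by simpa [Wr, h] using hy
          simp only [h, boolSign]
          norm_num
          nlinarith
      · simp [hy]
    refine (Finset.sum_le_sum fun k _ => h3 k).trans ?_
    rw [← ENNReal.ofReal_sum_of_nonneg fun k _ => sq_nonneg _, ← ofReal_norm,
      ← ENNReal.ofReal_pow (norm_nonneg _)]
    exact ENNReal.ofReal_le_ofReal h1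
  have hint : ∀ θ, ENNReal.ofReal (γ ^ 2 * ∑ k, (P θ).real (Wr θ k)) ≤
      ∫⁻ y, ‖est y - ∑ k, (γ * boolSign (θ k)) • w k‖ₑ ^ 2 ∂(P θ) := by
    intro θ
    refine le_trans (le_of_eq ?_) (lintegral_mono (hpt θ))
    rw [lintegral_finsetSum _ fun k _ => measurable_const.indicator (hWr θ k), Finset.mul_sum,
      ENNReal.ofReal_sum_of_nonneg fun k _ => mul_nonneg (sq_nonneg _) measureReal_nonneg]
    refine Finset.sum_congr rfl fun k _ => ?_
    rw [lintegral_indicator_const (hWr θ k), ENNReal.ofReal_mul (sq_nonneg _), ofReal_measureReal]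
  -- Averaging over the cube: reindexing by the flip of coordinate k makes twice the sum equal to a
  -- sum of pairs of test errors, each pair being at least 1/(4B).
  have hsum : ∀ k, (Fintype.card (K → Bool) : ℝ) * (1 / (8 * B k)) ≤
      ∑ θ, (P θ).real (Wr θ k) := by
    intro k
    have hinv : Function.Involutive fun θ : K → Bool => Function.update θ k (!θ k) := by
      intro θ
      simp
    have h1 : ∑ θ, (P θ).real (Wr θ k) = ∑ θ, (P (Function.update θ k (!θ k))).real (Wr θ k)ᶜ := by
      rw [← Equiv.sum_comp hinv.toPerm]
      refine Finset.sum_congr rfl fun θ _ => ?_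
      simp only [Function.Involutive.coe_toPerm, hflip]
    have h2 : ∑ θ : K → Bool, 1 / (4 * B k) ≤
        ∑ θ, ((P θ).real (Wr θ k) + (P (Function.update θ k (!θ k))).real (Wr θ k)ᶜ) :=
      Finset.sum_le_sum fun θ _ =>
        one_div_le_measureReal_add (hB k) (hWr θ k) (hP θ k _ (hWr θ k))
    rw [Finset.sum_add_distrib, ← h1, Finset.sum_const, Finset.card_univ, nsmul_eq_mul] at h2
    have h3 : 1 / (4 * B k) = 2 * (1 / (8 * B k)) := by
      have := hB k
      field_simp; norm_num
    rw [h3] at h2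
    linarith
  by_contra! hc
  have h1 : ∀ θ, γ ^ 2 * ∑ k, (P θ).real (Wr θ k) < γ ^ 2 * ∑ k, 1 / (8 * B k) := by
    intro θ
    exact (ENNReal.ofReal_lt_ofReal_iff_of_nonneg (mul_nonneg (sq_nonneg _)
      (Finset.sum_nonneg fun k _ => measureReal_nonneg))).1 ((hint θ).trans_lt (hc θ))
  have h2 := Finset.sum_lt_sum_of_nonempty Finset.univ_nonempty fun θ (_ : θ ∈ Finset.univ) => h1 θ
  rw [← Finset.mul_sum, Finset.sum_comm, Finset.sum_const, Finset.card_univ, nsmul_eq_mul] at h2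
  have h3 : γ ^ 2 * ∑ k, (Fintype.card (K → Bool) : ℝ) * (1 / (8 * B k)) ≤
      γ ^ 2 * ∑ k, ∑ θ, (P θ).real (Wr θ k) :=
    mul_le_mul_of_nonneg_left (Finset.sum_le_sum fun k _ => hsum k) (sq_nonneg _)
  rw [← Finset.mul_sum] at h3
  linarith

/-- A lower bound over many separated hypotheses close to a common one. -/
lemma exists_le_lintegral_of_separated {H K : Type*} [NormedAddCommGroup H] [Fintype K] [Nonempty K] {f : K → H} {r : ℝ} (hr : 0 ≤ r)
    (hf : ∀ k k', k ≠ k' → 2 * r ≤ ‖f k - f k'‖)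
    (P₀ : Measure Ω) [IsProbabilityMeasure P₀] (P : K → Measure Ω)
    [∀ k, IsProbabilityMeasure (P k)] {B : ℝ} (hB0 : 0 ≤ B) (hB : B ≤ Fintype.card K / 4)
    (hP : ∀ k, ∀ E, MeasurableSet E → P k E ^ 2 ≤ ENNReal.ofReal B * P₀ E)
    {est : Ω → H} (hest : StronglyMeasurable est) :
    ∃ k, ENNReal.ofReal (r ^ 2 / 2) ≤ ∫⁻ y, ‖est y - f k‖ₑ ^ 2 ∂(P k) := by
  -- Separation by 2r makes the events "the estimator is within r of `f k`" disjoint, so their total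
  -- mass under `P₀` is at most 1.
  let A : K → Set Ω := fun k => {y | ‖est y - f k‖ < r}
  have hA : ∀ k, MeasurableSet (A k) := fun k =>
    measurableSet_lt (hest.sub stronglyMeasurable_const).norm.measurable measurable_const
  have hdisj : Pairwise (Function.onFun Disjoint A) := by
    intro k k' hkk
    rw [Function.onFun, Set.disjoint_left]
    intro y h1 h2
    have h3 := hf k k' hkk
    have h4 : ‖f k - f k'‖ ≤ ‖est y - f k'‖ + ‖est y - f k‖ := by
      rw [show f k - f k' = (est y - f k') - (est y - f k) by abel]
      exact norm_sub_le _ _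
    simp only [A, Set.mem_ofPred_eq] at h1 h2
    linarith
  have h1 : ∀ k, (P k).real (A k) ^ 2 ≤ B * P₀.real (A k) := by
    intro k
    have := ENNReal.toReal_mono (by finiteness) (hP k _ (hA k))
    rwa [ENNReal.toReal_pow, ENNReal.toReal_mul, ENNReal.toReal_ofReal hB0] at this
  have h2 : ∑ k, P₀.real (A k) ≤ 1 := by
    rw [← measureReal_iUnion_fintype hdisj hA]
    exact measureReal_le_one
  have hcard : (0 : ℝ) < Fintype.card K := by exact_mod_cast Fintype.card_pos
  -- Cauchy–Schwarz over k: the average success probability is at most 1/2, so some hypothesis is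
  -- missed with probability at least 1/2.
  have h3 : (∑ k, (P k).real (A k)) ^ 2 ≤ (Fintype.card K / 2 : ℝ) ^ 2 := by
    calc (∑ k, (P k).real (A k)) ^ 2 ≤ Fintype.card K * ∑ k, (P k).real (A k) ^ 2 := by
          simpa using sq_sum_le_card_mul_sum_sq (s := Finset.univ) (f := fun k => (P k).real (A k))
      _ ≤ Fintype.card K * ∑ k, B * P₀.real (A k) := by gcongr with k; exact h1 k
      _ = Fintype.card K * B * ∑ k, P₀.real (A k) := by rw [← Finset.mul_sum]; ring
      _ ≤ Fintype.card K * (Fintype.card K / 4) * 1 := by gcongr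
      _ = _ := by ring
  have h4 : ∑ k, (P k).real (A k) ≤ Fintype.card K / 2 :=
    le_of_sq_le_sq h3 (by positivity)
  have h5 : ∃ k, (P k).real (A k) ≤ 1 / 2 := by
    by_contra! hc
    have := Finset.sum_lt_sum_of_nonempty Finset.univ_nonempty
      fun k (_ : k ∈ Finset.univ) => hc k
    rw [Finset.sum_const, Finset.card_univ, nsmul_eq_mul] at this
    linarith
  obtain ⟨k, hk⟩ := h5
  refine ⟨k, ?_⟩
  have h6 : (P k).real (A k)ᶜ = 1 - (P k).real (A k) := probReal_compl_eq_one_sub (hA k)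
  calc ENNReal.ofReal (r ^ 2 / 2) ≤ ENNReal.ofReal (r ^ 2 * (P k).real (A k)ᶜ) := by
        apply ENNReal.ofReal_le_ofReal
        nlinarith [sq_nonneg r]
    _ = ∫⁻ y, (A k)ᶜ.indicator (fun _ => ENNReal.ofReal (r ^ 2)) y ∂(P k) := by
        rw [lintegral_indicator_const (hA k).compl, ENNReal.ofReal_mul (sq_nonneg _),
          ofReal_measureReal]
    _ ≤ _ := by
        refine lintegral_mono fun y => ?_
        by_cases hy : y ∈ A k
        · simp [hy]
        · rw [Set.indicator_of_mem (by exact hy), ← ofReal_norm, ← ENNReal.ofReal_pow (norm_nonneg _)]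
          simp only [A, Set.mem_ofPred_eq, not_lt] at hy
          gcongr

end LowerBounds

end MultichannelDeconvolution

noncomputable section

namespace MultichannelDeconvolution

/-! ### Fourier coefficients of the periodized Meyer wavelets -/

/-- The character `x ↦ e^{2π i m x}`. -/
def expChar (m : ℤ) (x : ℝ) : ℂ := Complex.exp (2 * Real.pi * m * x * Complex.I)

/-- The `m`-th Fourier coefficient of `∑_i 2^{j/2} w (2^j (x + i) - k)`, where `h` is the Fourier
transform of `w`. -/
def periodizedCoef (h : ℝ → ℂ) (j k : ℕ) (m : ℤ) : ℂ :=
  ((2 : ℝ) ^ (-((j : ℝ) / 2)) : ℝ) *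
    (h (m / 2 ^ j) * Complex.exp (-(2 * Real.pi * m * (k / 2 ^ j) * Complex.I)))

/-- The even, smooth and compactly supported functions that are admissible Fourier transforms. -/
structure IsBandLimitedHat (h : ℝ → ℂ) : Prop where
  smooth : ContDiff ℝ ∞ h
  eq_zero : ∀ ξ, 4 / 3 ≤ |ξ| → h ξ = 0
  neg_eq : ∀ ξ, h (-ξ) = (starRingEnd ℂ) (h ξ)

lemma conj_fourierInv_eq {h : ℝ → ℂ} (hh : ∀ ξ, h (-ξ) = (starRingEnd ℂ) (h ξ)) (x : ℝ) :
    (starRingEnd ℂ) (𝓕⁻ h x) = 𝓕⁻ h x := by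
  rw [Real.fourierInv_eq', ← integral_conj, ← integral_neg_eq_self]
  refine integral_congr_ae (ae_of_all _ fun ξ => ?_)
  simp only [smul_eq_mul, map_mul, hh, Complex.conj_conj, ← Complex.exp_conj, Complex.conj_ofReal,
    Complex.conj_I]
  congr 2
  simp

/-- Hermitian symmetry makes the inverse transform real, so the real parts in the definitions of the
Meyer functions discard nothing. -/
lemma ofReal_re_fourierInv {h : ℝ → ℂ} (hh : ∀ ξ, h (-ξ) = (starRingEnd ℂ) (h ξ)) (x : ℝ) :
    (((𝓕⁻ h x).re : ℝ) : ℂ) = 𝓕⁻ h x :=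
  Complex.conj_eq_iff_re.1 (conj_fourierInv_eq hh x)

lemma fourierInv_rescaled (h : ℝ → ℂ) (j k : ℕ) (y : ℝ) :
    𝓕⁻ (fun ξ : ℝ => (((2 : ℝ) ^ (-((j : ℝ) / 2)) : ℝ) : ℂ) *
      (h (ξ / 2 ^ j) * Complex.exp (-(2 * Real.pi * ξ * (k / 2 ^ j) * Complex.I)))) y
      = (((2 : ℝ) ^ ((j : ℝ) / 2) : ℝ) : ℂ) * 𝓕⁻ h (2 ^ j * y - k) := by
  rw [Real.fourierInv_eq', Real.fourierInv_eq']
  have h1 := Measure.integral_comp_div (fun ξ : ℝ =>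
    Complex.exp (↑(2 * Real.pi * inner ℝ ξ (2 ^ j * y - k)) * Complex.I) • h ξ) ((2 : ℝ) ^ j)
  have h2 : (((2 : ℝ) ^ (-((j : ℝ) / 2)) : ℝ) : ℂ) * (|(2 : ℝ) ^ j| : ℝ)
      = (((2 : ℝ) ^ ((j : ℝ) / 2) : ℝ) : ℂ) := by
    rw [← Complex.ofReal_mul, abs_of_pos (by positivity), ← Real.rpow_natCast, ← Real.rpow_add two_pos]
    congr 2; ring
  rw [← h2, mul_assoc, ← Complex.real_smul (x := |(2 : ℝ) ^ j|), ← h1, ← integral_const_mul]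
  refine integral_congr_ae (ae_of_all _ fun ξ => ?_)
  simp only [smul_eq_mul, RCLike.inner_apply, conj_trivial]
  rw [mul_left_comm]
  congr 1
  rw [mul_comm (h _), ← mul_assoc, ← Complex.exp_add]
  congr 2
  push_cast
  field_simp
  ring

/-- Poisson summation for a dilated and translated band-limited function. -/
lemma ofReal_periodized_eq_sum {h : ℝ → ℂ} (hh : IsBandLimitedHat h) (j k : ℕ) (x : ℝ) :
    (periodized (fun x => (𝓕⁻ h x).re) j k x : ℂ) =
      ∑ m ∈ Finset.Ico (-(2 * 2 ^ j) : ℤ) (2 * 2 ^ j), periodizedCoef h j k m * expChar m x := by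
  -- The transform of the dilated and translated function. It is smooth with compact support, hence
  -- Schwartz, so Poisson summation applies to its inverse transform and the frequency side is a
  -- finite sum.
  let G : ℝ → ℂ := fun ξ => (((2 : ℝ) ^ (-((j : ℝ) / 2)) : ℝ) : ℂ) *
      (h (ξ / 2 ^ j) * Complex.exp (-(2 * Real.pi * ξ * (k / 2 ^ j) * Complex.I)))
  have hG0 : ∀ ξ : ℝ, 2 * 2 ^ j ≤ |ξ| → G ξ = 0 := by
    intro ξ hξ
    have : h (ξ / 2 ^ j) = 0 := by
      apply hh.eq_zero
      rw [abs_div, abs_of_pos (by positivity : (0 : ℝ) < 2 ^ j), le_div_iff₀ (by positivity)]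
      have : (0 : ℝ) < 2 ^ j := by positivity
      linarith
    simp [G, this]
  have hGc : HasCompactSupport G := by
    refine HasCompactSupport.of_support_subset_isCompact
      (isCompact_Icc (a := -(2 * 2 ^ j : ℝ)) (b := 2 * 2 ^ j)) ?_
    intro ξ hξ
    by_contra hc
    refine hξ (hG0 ξ ?_)
    rw [Set.mem_Icc, ← abs_le] at hc
    exact (not_le.1 hc).le
  have hGs : ContDiff ℝ ∞ G := by
    have h1 : ContDiff ℝ ∞ fun ξ : ℝ => h (ξ / 2 ^ j) :=
      hh.smooth.comp (contDiff_id.div_const _)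
    have h2 : ContDiff ℝ ∞ fun ξ : ℝ => (ξ : ℂ) := Complex.ofRealCLM.contDiff
    have h3 : ContDiff ℝ ∞ fun ξ : ℝ =>
        Complex.exp (-(2 * Real.pi * ξ * (k / 2 ^ j) * Complex.I)) := by fun_prop
    exact contDiff_const.mul (h1.mul h3)
  have hfG : ∀ n : ℤ, (𝓕 (𝓕⁻ (hGc.toSchwartzMap hGs))) (n : ℝ) = G n := by
    intro n
    rw [FourierTransform.fourier_fourierInv_eq]
    simp
  have hinv : ∀ y, (𝓕⁻ (hGc.toSchwartzMap hGs)) y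
      = (((2 : ℝ) ^ ((j : ℝ) / 2) * (𝓕⁻ h (2 ^ j * y - k)).re : ℝ) : ℂ) := by
    intro y
    rw [SchwartzMap.fourierInv_coe, Complex.ofReal_mul, ofReal_re_fourierInv hh.neg_eq,
      ← fourierInv_rescaled]
    rfl
  have hP := SchwartzMap.tsum_eq_tsum_fourier (𝓕⁻ (hGc.toSchwartzMap hGs)) x
  simp_rw [hinv, hfG] at hP
  rw [periodized, Complex.ofReal_tsum, hP, tsum_eq_sum]
  · refine Finset.sum_congr rfl fun m _ => ?_
    rw [fourier_coe_apply, expChar]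
    congr 2
    push_cast; ring
  · intro m hm
    rw [hG0, zero_mul]
    rw [Finset.mem_Ico, not_and_or] at hm
    have h3 : (2 * 2 ^ j : ℤ) ≤ |m| := by
      rw [le_abs]
      omega
    exact_mod_cast h3

/-! ### The Fourier transforms of the Meyer functions -/

section Meyer

variable {v : ℝ → ℝ} (hv : IsMeyerAux v)
include hv

/-- The kink of the absolute value at 0 is harmless: the argument of `v` is near -1 there, where `v`
vanishes. -/
lemma IsMeyerAux.contDiff_comp_abs (c : ℝ) :
    ContDiff ℝ ∞ fun ξ : ℝ => v (c * |ξ| - 1) := by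
  rw [contDiff_iff_contDiffAt]
  intro ξ
  by_cases h : ξ = 0
  · have h1 : ∀ᶠ η in nhds ξ, c * |η| - 1 < 0 := by
      apply ContinuousAt.eventually_lt (by fun_prop) continuousAt_const
      simp [h]
    refine (contDiffAt_const (c := (0 : ℝ))).congr_of_eventuallyEq ?_
    filter_upwards [h1] with η hη using hv.eq_zero _ hη.le
  · exact hv.smooth.contDiffAt.comp ξ ((contDiffAt_const.mul (contDiffAt_abs h)).sub contDiffAt_const)

lemma meyerScalingHat_eq_zero {ξ : ℝ} (hξ : 2 / 3 ≤ |ξ|) : meyerScalingHat v ξ = 0 := by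
  rw [meyerScalingHat, hv.eq_one _ (by linarith)]; simp

lemma meyerWaveletHat_eq_zero {ξ : ℝ} (hξ : |ξ| ≤ 1 / 3 ∨ 4 / 3 ≤ |ξ|) :
    meyerWaveletHat v ξ = 0 := by
  rcases hξ with hξ | hξ
  · rw [meyerWaveletHat, hv.eq_zero (3 * |ξ| - 1) (by linarith)]; simp
  · rw [meyerWaveletHat, hv.eq_one (3 * |ξ| / 2 - 1) (by linarith)]; simp

lemma isBandLimitedHat_meyerScalingHat : IsBandLimitedHat (meyerScalingHat v) where
  smooth := by
    have h1 := hv.contDiff_comp_abs 3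
    exact Complex.ofRealCLM.contDiff.comp (Real.contDiff_cos.comp (contDiff_const.mul h1))
  eq_zero ξ hξ := meyerScalingHat_eq_zero hv (by linarith)
  neg_eq ξ := by simp only [meyerScalingHat, abs_neg, Complex.conj_ofReal]

lemma isBandLimitedHat_meyerWaveletHat : IsBandLimitedHat (meyerWaveletHat v) where
  smooth := by
    have h1 := hv.contDiff_comp_abs 3
    have h2 := hv.contDiff_comp_abs (3 / 2)
    have h3 : ContDiff ℝ ∞ fun ξ : ℝ => (ξ : ℂ) := Complex.ofRealCLM.contDiff
    have h4 : ContDiff ℝ ∞ fun ξ : ℝ => (Real.sin (Real.pi / 2 * v (3 * |ξ| - 1)) *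
        Real.cos (Real.pi / 2 * v (3 / 2 * |ξ| - 1)) : ℝ) :=
      (Real.contDiff_sin.comp (contDiff_const.mul h1)).mul
        (Real.contDiff_cos.comp (contDiff_const.mul h2))
    have h5 := Complex.ofRealCLM.contDiff.comp h4
    have h6 : ContDiff ℝ ∞ fun ξ : ℝ => Complex.exp (-(Real.pi * ξ * Complex.I)) := by fun_prop
    convert! h6.mul h5 using 2 with ξ
    simp only [meyerWaveletHat, Function.comp, Complex.ofRealCLM_apply]
    congr 6
    ring
  eq_zero ξ hξ := meyerWaveletHat_eq_zero hv (Or.inr hξ)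
  neg_eq ξ := by
    simp only [meyerWaveletHat, abs_neg, map_mul, Complex.conj_ofReal, ← Complex.exp_conj]
    congr 2
    simp

/-- The product of the Fourier transforms of neighbouring Meyer functions, without its phase. -/
def meyerOverlap (v : ℝ → ℝ) (ξ : ℝ) : ℝ :=
  Real.sin (Real.pi / 2 * v (3 * |ξ| - 1)) * Real.cos (Real.pi / 2 * v (3 * |ξ| - 1))

lemma meyerOverlap_eq_zero {ξ : ℝ} (hξ : 2 / 3 ≤ |ξ|) : meyerOverlap v ξ = 0 := by
  rw [meyerOverlap, hv.eq_one _ (by linarith)]; simp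

/-- For |ξ| ≤ 2/3 the outer cosine factor of the wavelet is 1; beyond that the scaling function
vanishes. -/
lemma meyerWaveletHat_mul_conj_meyerScalingHat (ξ : ℝ) :
    meyerWaveletHat v ξ * (starRingEnd ℂ) (meyerScalingHat v ξ)
      = Complex.exp (-(Real.pi * ξ * Complex.I)) * (meyerOverlap v ξ : ℂ) := by
  rw [meyerWaveletHat, meyerScalingHat, Complex.conj_ofReal, mul_assoc, ← Complex.ofReal_mul]
  congr 2
  rcases le_total |ξ| (2 / 3) with h | h
  · rw [hv.eq_zero (3 * |ξ| / 2 - 1) (by linarith), meyerOverlap]; simp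
  · rw [meyerOverlap_eq_zero hv h, hv.eq_one (3 * |ξ| - 1) (by linarith)]; simp

/-- Doubling ξ turns the outer cosine of the wavelet into that of the overlap. The remaining factors
equal 1 for 1/3 ≤ |ξ| ≤ 2/3, and outside this range both sides vanish. -/
lemma meyerWaveletHat_mul_conj_meyerWaveletHat_two_mul (ξ : ℝ) :
    meyerWaveletHat v ξ * (starRingEnd ℂ) (meyerWaveletHat v (2 * ξ))
      = Complex.exp (Real.pi * ξ * Complex.I) * (meyerOverlap v ξ : ℂ) := by
  rw [meyerWaveletHat, meyerWaveletHat, map_mul, Complex.conj_ofReal, mul_mul_mul_comm,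
    ← Complex.ofReal_mul, ← Complex.exp_conj, ← Complex.exp_add]
  congr 2
  · simp [Complex.conj_ofNat]; ring
  · have h0 : |2 * ξ| = 2 * |ξ| := by rw [abs_mul]; simp
    have h1 : 3 * (2 * |ξ|) / 2 - 1 = 3 * |ξ| - 1 := by ring
    rw [h0, h1]
    rcases le_total |ξ| (1 / 3) with h | h
    · rw [meyerOverlap, hv.eq_zero (3 * |ξ| - 1) (by linarith)]; simp
    · rcases le_total |ξ| (2 / 3) with h' | h'
      · rw [hv.eq_one (3 * (2 * |ξ|) - 1) (by linarith),
          hv.eq_zero (3 * |ξ| / 2 - 1) (by linarith), meyerOverlap]; simp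
      · rw [meyerOverlap_eq_zero hv h', hv.eq_one (3 * |ξ| - 1) (by linarith)]; simp

/-- Only the shifts ξ and ξ - 1 meet the support. The symmetry of `v` exchanges sine and cosine, so
the overlap agrees at these two points, while a unit shift changes the sign of the phase. -/
lemma sum_phase_mul_meyerOverlap {c : ℂ} (hc : c = Complex.I ∨ c = -Complex.I) {ξ : ℝ}
    (h0 : 0 ≤ ξ) (h1 : ξ < 1) :
    Complex.exp (Real.pi * (ξ - 2 : ℝ) * c) * (meyerOverlap v (ξ - 2) : ℂ) +
      Complex.exp (Real.pi * (ξ - 1 : ℝ) * c) * (meyerOverlap v (ξ - 1) : ℂ) +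
      Complex.exp (Real.pi * ξ * c) * (meyerOverlap v ξ : ℂ) +
      Complex.exp (Real.pi * (ξ + 1 : ℝ) * c) * (meyerOverlap v (ξ + 1) : ℂ) = 0 := by
  rw [meyerOverlap_eq_zero hv (ξ := ξ - 2) (by rw [abs_of_neg] <;> linarith),
    meyerOverlap_eq_zero hv (ξ := ξ + 1) (by rw [abs_of_pos] <;> linarith)]
  have h2 : meyerOverlap v (ξ - 1) = meyerOverlap v ξ := by
    have h3 := hv.add_symm (3 * ξ - 1)
    rw [meyerOverlap, meyerOverlap, abs_of_neg (by linarith : ξ - 1 < 0), abs_of_nonneg h0,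
      show 3 * -(ξ - 1) - 1 = 1 - (3 * ξ - 1) by ring, eq_sub_of_add_eq' h3, mul_sub, mul_one,
      Real.sin_pi_div_two_sub, Real.cos_pi_div_two_sub, mul_comm]
  have h3 : Complex.exp (Real.pi * (ξ - 1 : ℝ) * c) = -Complex.exp (Real.pi * ξ * c) := by
    have : Complex.exp (-(Real.pi * c)) = -1 := by
      rcases hc with rfl | rfl
      · rw [Complex.exp_neg, Complex.exp_pi_mul_I]; norm_num
      · rw [mul_neg, neg_neg, Complex.exp_pi_mul_I]
    rw [show (Real.pi * (ξ - 1 : ℝ) * c : ℂ) = Real.pi * ξ * c + -(Real.pi * c) by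
      push_cast; ring, Complex.exp_add, this]
    ring
  rw [h2, h3]
  simp

/-- On each third of [0, 1) at most two shifts survive, and the symmetry of `v` makes them the
squared sine and cosine of one angle. -/
lemma sum_norm_sq_meyerWaveletHat {ξ : ℝ} (h0 : 0 ≤ ξ) (h1 : ξ < 1) :
    ‖meyerWaveletHat v (ξ - 2)‖ ^ 2 + ‖meyerWaveletHat v (ξ - 1)‖ ^ 2 +
      ‖meyerWaveletHat v ξ‖ ^ 2 + ‖meyerWaveletHat v (ξ + 1)‖ ^ 2 = 1 := by
  have hn : ∀ η, ‖meyerWaveletHat v η‖ ^ 2 = Real.sin (Real.pi / 2 * v (3 * |η| - 1)) ^ 2 *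
      Real.cos (Real.pi / 2 * v (3 * |η| / 2 - 1)) ^ 2 := by
    intro η
    rw [meyerWaveletHat, norm_mul, Complex.norm_real,
      show (-(Real.pi * η * Complex.I) : ℂ) = (-(Real.pi * η) : ℝ) * Complex.I by push_cast; ring,
      Complex.norm_exp_ofReal_mul_I, one_mul, Real.norm_eq_abs, sq_abs, mul_pow]
  have hA := eq_sub_of_add_eq' (hv.add_symm (3 * ξ - 1))
  have hB := eq_sub_of_add_eq' (hv.add_symm (3 * ξ / 2 - 1))
  have hD := eq_sub_of_add_eq' (hv.add_symm (3 * ξ / 2 + 1 / 2))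
  have e1 : |ξ - 2| = 2 - ξ := by rw [abs_of_neg] <;> linarith
  have e2 : |ξ - 1| = 1 - ξ := by rw [abs_of_neg] <;> linarith
  have e3 : |ξ + 1| = ξ + 1 := abs_of_pos (by linarith)
  simp only [hn, e1, e2, e3, abs_of_nonneg h0]
  rw [hv.eq_one (3 * (2 - ξ) - 1) (by linarith), hv.eq_one (3 * (ξ + 1) - 1) (by linarith),
    show 3 * (2 - ξ) / 2 - 1 = 1 - (3 * ξ / 2 - 1) by ring, hB,
    show 3 * (1 - ξ) - 1 = 1 - (3 * ξ - 1) by ring, hA,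
    show 3 * (1 - ξ) / 2 - 1 = 1 - (3 * ξ / 2 + 1 / 2) by ring, hD,
    show 3 * (ξ + 1) / 2 - 1 = 3 * ξ / 2 + 1 / 2 by ring]
  simp only [mul_sub, mul_one, Real.sin_pi_div_two_sub, Real.cos_pi_div_two_sub,
    Real.sin_pi_div_two]
  rcases le_total ξ (1 / 3) with h | h
  · rw [hv.eq_zero (3 * ξ - 1) (by linarith), hv.eq_zero (3 * ξ / 2 - 1) (by linarith)]
    simp
  · rw [hv.eq_one (3 * ξ / 2 + 1 / 2) (by linarith)]
    rcases le_total ξ (2 / 3) with h' | h'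
    · rw [hv.eq_zero (3 * ξ / 2 - 1) (by linarith)]
      simp
    · rw [hv.eq_one (3 * ξ - 1) (by linarith)]
      simp

end Meyer

end MultichannelDeconvolution

end

noncomputable section

namespace MultichannelDeconvolution

/-! ### Orthogonality of the Fourier coefficients of the periodized Meyer wavelets -/

lemma sum_Ico_eq_sum_range_shifts (F : ℤ → ℂ) (J : ℕ) :
    ∑ m ∈ Finset.Ico (-(2 * J) : ℤ) (2 * J), F m =
      ∑ r ∈ Finset.range J, (F (r - 2 * J) + F (r - J) + F r + F (r + J)) := by
  have hshift : ∀ a : ℤ, ∑ m ∈ Finset.Ico a (a + J), F m = ∑ r ∈ Finset.range J, F (r + a) := by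
    intro a
    refine (Finset.sum_bij (fun (r : ℕ) _ => (r : ℤ) + a) ?_ ?_ ?_ ?_).symm
    · intro r hr
      simp only [Finset.mem_range, Finset.mem_Ico] at hr ⊢
      omega
    · intro r _ r' _ h
      simpa using h
    · intro m hm
      simp only [Finset.mem_Ico] at hm
      refine ⟨(m - a).toNat, ?_, ?_⟩
      · simp only [Finset.mem_range]; omega
      · omega
    · intro r _; rfl
  have hcons : ∀ {a b c : ℤ}, a ≤ b → b ≤ c →
      ∑ m ∈ Finset.Ico a b, F m + ∑ m ∈ Finset.Ico b c, F m = ∑ m ∈ Finset.Ico a c, F m := by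
    intro a b c hab hbc
    rw [← Finset.sum_union (Finset.Ico_disjoint_Ico_consecutive a b c),
      Finset.Ico_union_Ico_eq_Ico hab hbc]
  have h1 := hshift (-(2 * J))
  have h2 := hshift (-J)
  have h3 := hshift 0
  have h4 := hshift J
  rw [show (-(2 * J) + J : ℤ) = -J by ring] at h1
  rw [show (-J + J : ℤ) = 0 by ring] at h2
  rw [zero_add] at h3
  rw [show (J + J : ℤ) = 2 * J by ring] at h4
  simp only [Finset.sum_add_distrib, sub_eq_add_neg]
  rw [← h1, ← h2, ← h4]
  simp only [add_zero] at h3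
  rw [← h3, hcons (by omega) (by omega), hcons (by omega) (by omega), hcons (by omega) (by omega)]

/-- Folding modulo `J`: the periodic factor comes out, and the window [-2J, 2J) contributes exactly
four unit shifts of `H`. -/
lemma sum_periodic_mul_eq {J : ℕ} (hJ : 0 < J) {χ : ℤ → ℂ} (hχ : ∀ m, χ (m + J) = χ m)
    {H : ℝ → ℂ} {c : ℂ}
    (hH : ∀ ξ, 0 ≤ ξ → ξ < 1 → H (ξ - 2) + H (ξ - 1) + H ξ + H (ξ + 1) = c) :
    ∑ m ∈ Finset.Ico (-(2 * J) : ℤ) (2 * J), χ m * H (m / J) =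
      c * ∑ r ∈ Finset.range J, χ r := by
  rw [sum_Ico_eq_sum_range_shifts, Finset.mul_sum]
  refine Finset.sum_congr rfl fun r hr => ?_
  have h1 : χ (r - J) = χ r := by rw [← hχ (r - J)]; congr 1; ring
  have h2 : χ (r - 2 * J) = χ r := by rw [← h1, ← hχ (r - 2 * J)]; congr 1; ring
  have hJ' : (J : ℝ) ≠ 0 := by positivity
  rw [hχ, h1, h2, ← hH (r / J) (by positivity)
    ((div_lt_one (by positivity)).2 (by exact_mod_cast Finset.mem_range.1 hr))]
  have e1 : (((r - 2 * J : ℤ) : ℝ) / J) = r / J - 2 := by push_cast; field_simp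
  have e2 : (((r - J : ℤ) : ℝ) / J) = r / J - 1 := by push_cast; field_simp
  have e3 : (((r + J : ℤ) : ℝ) / J) = r / J + 1 := by push_cast; field_simp
  rw [e1, e2, e3]
  push_cast
  ring

lemma periodizedCoef_mul_conj (h h' : ℝ → ℂ) (j k j' k' : ℕ) (m : ℤ) :
    periodizedCoef h j k m * (starRingEnd ℂ) (periodizedCoef h' j' k' m) =
      (((2 : ℝ) ^ (-((j : ℝ) / 2)) * (2 : ℝ) ^ (-((j' : ℝ) / 2)) : ℝ) : ℂ) *
        (Complex.exp (2 * Real.pi * m * (k' / 2 ^ j' - k / 2 ^ j) * Complex.I) *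
          (h (m / 2 ^ j) * (starRingEnd ℂ) (h' (m / 2 ^ j')))) := by
  simp only [periodizedCoef, map_mul, Complex.conj_ofReal, ← Complex.exp_conj]
  have h1 : (starRingEnd ℂ) (-(2 * Real.pi * m * (k' / 2 ^ j') * Complex.I))
      = 2 * Real.pi * m * (k' / 2 ^ j') * Complex.I := by
    simp [Complex.conj_ofNat]
  rw [h1, mul_sub, sub_mul, sub_eq_neg_add, Complex.exp_add]
  push_cast
  ring

lemma exp_int_mul_periodic {J : ℕ} (hJ : 0 < J) (a : ℤ) (m : ℤ) :
    Complex.exp (2 * Real.pi * ((m + J : ℤ) : ℂ) * (a / J) * Complex.I)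
      = Complex.exp (2 * Real.pi * m * (a / J) * Complex.I) := by
  have hJ' : (J : ℂ) ≠ 0 := by exact_mod_cast hJ.ne'
  rw [show (2 * Real.pi * ((m + J : ℤ) : ℂ) * (a / J) * Complex.I : ℂ)
    = 2 * Real.pi * m * (a / J) * Complex.I + a * (2 * Real.pi * Complex.I) by
      push_cast; field_simp, Complex.exp_add, Complex.exp_int_mul_two_pi_mul_I, mul_one]

lemma sum_range_exp_eq {J : ℕ} {k k' : ℕ} (hk : k < J) (hk' : k' < J) :
    ∑ r ∈ Finset.range J,
      Complex.exp (2 * Real.pi * ((r : ℤ) : ℂ) * (((k' : ℤ) - k : ℤ) / J) * Complex.I)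
      = if k = k' then (J : ℂ) else 0 := by
  have hJ : 0 < J := by omega
  have hJ' : (J : ℂ) ≠ 0 := by exact_mod_cast hJ.ne'
  split_ifs with h
  · simp [h]
  · set z := Complex.exp (2 * Real.pi * (((k' : ℤ) - k : ℤ) / J) * Complex.I) with hz
    have h1 : ∀ r : ℕ, Complex.exp (2 * Real.pi * ((r : ℤ) : ℂ) * (((k' : ℤ) - k : ℤ) / J) *
        Complex.I) = z ^ r := by
      intro r
      rw [hz, ← Complex.exp_nat_mul]
      congr 1; push_cast; ring
    simp_rw [h1]
    have hz1 : z ≠ 1 := by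
      rw [hz, Ne, Complex.exp_eq_one_iff]
      rintro ⟨n, hn⟩
      have h2 : (((k' : ℤ) - k : ℤ) : ℂ) = ((n * J : ℤ) : ℂ) := by
        have h3 : (2 * Real.pi * Complex.I : ℂ) ≠ 0 := Complex.two_pi_I_ne_zero
        have h4 : (2 * Real.pi * Complex.I : ℂ) * ((((k' : ℤ) - k : ℤ) : ℂ) / J)
            = (2 * Real.pi * Complex.I) * n := by rw [mul_comm _ (n : ℂ), ← hn]; ring
        have h5 := mul_left_cancel₀ h3 h4
        rw [div_eq_iff hJ'] at h5
        rw [h5]; push_cast; ring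
      have h3 : (k' : ℤ) - k = n * J := by exact_mod_cast h2
      have h4 : n = 0 := by
        by_contra hn0
        rcases lt_or_gt_of_ne hn0 with h5 | h5
        · have : n * J ≤ -1 * J := mul_le_mul_of_nonneg_right (by omega) (by omega)
          omega
        · have : 1 * (J : ℤ) ≤ n * J := mul_le_mul_of_nonneg_right (by omega) (by omega)
          omega
      rw [h4] at h3
      omega
    rw [geom_sum_eq hz1]
    have hzJ : z ^ J = 1 := by
      rw [hz, ← Complex.exp_nat_mul, show ((J : ℂ) * (2 * Real.pi * (((k' : ℤ) - k : ℤ) / J) *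
        Complex.I) : ℂ) = ((k' : ℤ) - k : ℤ) * (2 * Real.pi * Complex.I) by field_simp,
        Complex.exp_int_mul_two_pi_mul_I]
    simp [hzJ]

section Meyer

variable {v : ℝ → ℝ} (hv : IsMeyerAux v)
include hv

/-- After folding, the squared moduli sum to 1 and the orthogonality of characters modulo 2^j
remains. -/
lemma sum_waveletCoef_mul_conj_same (j : ℕ) {k k' : ℕ} (hk : k < 2 ^ j) (hk' : k' < 2 ^ j) :
    ∑ m ∈ Finset.Ico (-(2 * 2 ^ j) : ℤ) (2 * 2 ^ j),
      periodizedCoef (meyerWaveletHat v) j k m *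
        (starRingEnd ℂ) (periodizedCoef (meyerWaveletHat v) j k' m)
      = if k = k' then 1 else 0 := by
  simp_rw [periodizedCoef_mul_conj]
  rw [← Finset.mul_sum]
  have h1 := sum_periodic_mul_eq (J := 2 ^ j) (by positivity)
    (χ := fun m => Complex.exp (2 * Real.pi * m * (((k' : ℤ) - k : ℤ) / ((2 ^ j : ℕ) : ℂ)) *
      Complex.I))
    (fun m => exp_int_mul_periodic (by positivity) _ _)
    (H := fun ξ => meyerWaveletHat v ξ * (starRingEnd ℂ) (meyerWaveletHat v ξ)) (c := 1)
    (by
      intro ξ h0 h1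
      simp only [Complex.mul_conj']
      exact_mod_cast sum_norm_sq_meyerWaveletHat hv h0 h1)
  rw [sum_range_exp_eq hk hk'] at h1
  have h2 : (((2 : ℝ) ^ (-((j : ℝ) / 2)) * (2 : ℝ) ^ (-((j : ℝ) / 2)) : ℝ) : ℂ) * ((2 ^ j : ℕ) : ℂ)
      = 1 := by
    rw [← Real.rpow_add two_pos, ← Complex.ofReal_natCast, ← Complex.ofReal_mul,
      Nat.cast_pow, Nat.cast_ofNat, ← Real.rpow_natCast, ← Real.rpow_add two_pos,
      show -((j : ℝ) / 2) + -((j : ℝ) / 2) + j = 0 by ring]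
    simp
  calc _ = (((2 : ℝ) ^ (-((j : ℝ) / 2)) * (2 : ℝ) ^ (-((j : ℝ) / 2)) : ℝ) : ℂ) *
        (1 * if k = k' then ((2 ^ j : ℕ) : ℂ) else 0) := by
        rw [← h1]
        congr 1
        push_cast
        refine Finset.sum_congr rfl fun m _ => ?_
        simp [sub_div]
    _ = _ := by
        split_ifs
        · rw [one_mul, h2]
        · simp

lemma sum_waveletCoef_mul_conj_scalingCoef (j k k' : ℕ) :
    ∑ m ∈ Finset.Ico (-(2 * 2 ^ j) : ℤ) (2 * 2 ^ j),
      periodizedCoef (meyerWaveletHat v) j k m *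
        (starRingEnd ℂ) (periodizedCoef (meyerScalingHat v) j k' m) = 0 := by
  simp_rw [periodizedCoef_mul_conj]
  rw [← Finset.mul_sum]
  have h1 := sum_periodic_mul_eq (J := 2 ^ j) (by positivity)
    (χ := fun m => Complex.exp (2 * Real.pi * m * (((k' : ℤ) - k : ℤ) / ((2 ^ j : ℕ) : ℂ)) *
      Complex.I))
    (fun m => exp_int_mul_periodic (by positivity) _ _)
    (H := fun ξ => meyerWaveletHat v ξ * (starRingEnd ℂ) (meyerScalingHat v ξ)) (c := 0)
    (by
      intro ξ h0 h1
      simp only [meyerWaveletHat_mul_conj_meyerScalingHat hv]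
      have := sum_phase_mul_meyerOverlap hv (Or.inr rfl) h0 h1
      simpa only [mul_neg] using this)
  rw [zero_mul] at h1
  refine mul_eq_zero_of_right _ ?_
  rw [← h1]
  push_cast
  refine Finset.sum_congr rfl fun m _ => ?_
  simp [sub_div]

/-- The coarser phase k'/2^j is 2k'/2^(j+1), hence still periodic modulo the finer 2^(j+1); the
folded product of neighbouring transforms is 0. -/
lemma sum_waveletCoef_mul_conj_succ (j k k' : ℕ) :
    ∑ m ∈ Finset.Ico (-(2 * 2 ^ (j + 1)) : ℤ) (2 * 2 ^ (j + 1)),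
      periodizedCoef (meyerWaveletHat v) (j + 1) k m *
        (starRingEnd ℂ) (periodizedCoef (meyerWaveletHat v) j k' m) = 0 := by
  simp_rw [periodizedCoef_mul_conj]
  rw [← Finset.mul_sum]
  have h1 := sum_periodic_mul_eq (J := 2 ^ (j + 1)) (by positivity)
    (χ := fun m => Complex.exp (2 * Real.pi * m * ((2 * (k' : ℤ) - k : ℤ) /
      ((2 ^ (j + 1) : ℕ) : ℂ)) * Complex.I))
    (fun m => exp_int_mul_periodic (by positivity) _ _)
    (H := fun ξ => meyerWaveletHat v ξ * (starRingEnd ℂ) (meyerWaveletHat v (2 * ξ))) (c := 0)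
    (by
      intro ξ h0 h1
      simp only [meyerWaveletHat_mul_conj_meyerWaveletHat_two_mul hv]
      exact sum_phase_mul_meyerOverlap hv (Or.inl rfl) h0 h1)
  rw [zero_mul] at h1
  refine mul_eq_zero_of_right _ ?_
  rw [← h1]
  push_cast
  refine Finset.sum_congr rfl fun m _ => ?_
  congr 2
  · rw [sub_div]
    congr 2
    rw [pow_succ]; field_simp
  · rw [pow_succ]
    congr 3
    field_simp

/-- Two levels apart the frequency bands are disjoint: 2^j'/3 is at least (4/3) 2^j. -/
lemma waveletCoef_mul_conj_eq_zero {j j' : ℕ} (hj : j + 2 ≤ j') (k k' : ℕ) (m : ℤ) :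
    periodizedCoef (meyerWaveletHat v) j' k' m *
      (starRingEnd ℂ) (periodizedCoef (meyerWaveletHat v) j k m) = 0 := by
  have h2 : (4 : ℝ) * 2 ^ j ≤ 2 ^ j' := by
    calc (4 : ℝ) * 2 ^ j = 2 ^ (j + 2) := by rw [pow_add]; norm_num; ring
      _ ≤ 2 ^ j' := pow_le_pow_right₀ (by norm_num) hj
  have hj0 : (0 : ℝ) < 2 ^ j := by positivity
  have hj0' : (0 : ℝ) < 2 ^ j' := by positivity
  rw [periodizedCoef_mul_conj]
  by_cases h : |(m : ℝ) / 2 ^ j'| ≤ 1 / 3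
  · rw [meyerWaveletHat_eq_zero hv (Or.inl h)]; simp
  · rw [meyerWaveletHat_eq_zero hv (ξ := m / 2 ^ j) (Or.inr ?_)]
    · simp
    · rw [abs_div, abs_of_pos hj0', not_le, lt_div_iff₀ hj0'] at h
      rw [abs_div, abs_of_pos hj0, le_div_iff₀ hj0]
      linarith

lemma waveletCoef_mul_conj_scalingCoef_eq_zero {j j' : ℕ} (hj : j < j') (k k' : ℕ) (m : ℤ) :
    periodizedCoef (meyerWaveletHat v) j' k' m *
      (starRingEnd ℂ) (periodizedCoef (meyerScalingHat v) j k m) = 0 := by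
  have h2 : (2 : ℝ) * 2 ^ j ≤ 2 ^ j' := by
    calc (2 : ℝ) * 2 ^ j = 2 ^ (j + 1) := by rw [pow_succ]; ring
      _ ≤ 2 ^ j' := pow_le_pow_right₀ (by norm_num) hj
  have hj0 : (0 : ℝ) < 2 ^ j := by positivity
  have hj0' : (0 : ℝ) < 2 ^ j' := by positivity
  rw [periodizedCoef_mul_conj]
  by_cases h : |(m : ℝ) / 2 ^ j'| ≤ 1 / 3
  · rw [meyerWaveletHat_eq_zero hv (Or.inl h)]; simp
  · rw [meyerScalingHat_eq_zero hv (ξ := m / 2 ^ j) ?_]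
    · simp
    · rw [abs_div, abs_of_pos hj0', not_le, lt_div_iff₀ hj0'] at h
      rw [abs_div, abs_of_pos hj0, le_div_iff₀ hj0]
      linarith

end Meyer

end MultichannelDeconvolution

end

noncomputable section

namespace MultichannelDeconvolution

/-! ### Trigonometric polynomials in `L²(T)` -/

instance : IsProbabilityMeasure volT := ⟨by simp [volT]⟩

lemma integral_volT_eq_intervalIntegral {E : Type*} [NormedAddCommGroup E] [NormedSpace ℝ E]
    (f : ℝ → E) : ∫ x, f x ∂volT = ∫ x in (0 : ℝ)..1, f x := by
  rw [volT, integral_Icc_eq_integral_Ioc, intervalIntegral.integral_of_le zero_le_one]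

lemma integrable_volT_iff {E : Type*} [NormedAddCommGroup E] (f : ℝ → E) :
    Integrable f volT ↔ IntervalIntegrable f volume 0 1 := by
  rw [intervalIntegrable_iff_integrableOn_Icc_of_le zero_le_one, volT, IntegrableOn]

lemma continuous_expChar (m : ℤ) : Continuous (expChar m) := by
  unfold expChar; fun_prop

lemma expChar_add (m n : ℤ) (x : ℝ) : expChar (m + n) x = expChar m x * expChar n x := by
  rw [expChar, expChar, expChar, ← Complex.exp_add]
  congr 1; push_cast; ring

lemma conj_expChar (m : ℤ) (x : ℝ) : (starRingEnd ℂ) (expChar m x) = expChar (-m) x := by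
  rw [expChar, expChar, ← Complex.exp_conj]
  congr 1
  simp [Complex.conj_ofNat]

lemma norm_expChar (m : ℤ) (x : ℝ) : ‖expChar m x‖ = 1 := by
  rw [expChar, show (2 * Real.pi * m * x * Complex.I : ℂ) = (2 * Real.pi * m * x : ℝ) * Complex.I by
    push_cast; ring, Complex.norm_exp_ofReal_mul_I]

lemma integral_expChar (m : ℤ) : ∫ x, expChar m x ∂volT = if m = 0 then 1 else 0 := by
  rw [integral_volT_eq_intervalIntegral]
  split_ifs with h
  · simp [expChar, h]
  · have hc : (2 * Real.pi * m * Complex.I : ℂ) ≠ 0 := by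
      have : (m : ℂ) ≠ 0 := by exact_mod_cast h
      simp [Real.pi_ne_zero, this]
    have h1 := integral_exp_mul_complex (a := 0) (b := 1) hc
    have h2 : ∀ x : ℝ, expChar m x = Complex.exp (2 * Real.pi * m * Complex.I * x) := by
      intro x; rw [expChar]; congr 1; ring
    simp_rw [h2]
    rw [h1]
    have h3 : Complex.exp (2 * Real.pi * m * Complex.I * (1 : ℝ)) = 1 := by
      rw [show (2 * Real.pi * m * Complex.I * (1 : ℝ) : ℂ) = m * (2 * Real.pi * Complex.I) by
        push_cast; ring, Complex.exp_int_mul_two_pi_mul_I]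
    rw [h3]; simp

lemma integrable_of_continuous_volT {E : Type*} [NormedAddCommGroup E] {f : ℝ → E}
    (hf : Continuous f) : Integrable f volT :=
  (integrable_volT_iff f).2 (hf.intervalIntegrable 0 1)

lemma integral_mul_eq_sum {f f' : ℝ → ℝ} {s : Finset ℤ} {c c' : ℤ → ℂ}
    (hf : ∀ x, (f x : ℂ) = ∑ m ∈ s, c m * expChar m x)
    (hf' : ∀ x, (f' x : ℂ) = ∑ m ∈ s, c' m * expChar m x) :
    ((∫ x, f x * f' x ∂volT : ℝ) : ℂ) = ∑ m ∈ s, c m * (starRingEnd ℂ) (c' m) := by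
  have h1 : ∀ x, ((f x * f' x : ℝ) : ℂ)
      = ∑ m ∈ s, ∑ m' ∈ s, c m * (starRingEnd ℂ) (c' m') * expChar (m - m') x := by
    intro x
    rw [Complex.ofReal_mul, hf, ← Complex.conj_ofReal (f' x), hf', map_sum, Finset.sum_mul_sum]
    refine Finset.sum_congr rfl fun m _ => Finset.sum_congr rfl fun m' _ => ?_
    rw [map_mul, conj_expChar, sub_eq_add_neg, expChar_add]
    ring
  rw [← integral_complex_ofReal]
  simp_rw [h1]
  have hint : ∀ m m', Integrable (fun x => c m * (starRingEnd ℂ) (c' m') * expChar (m - m') x)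
      volT := fun m m' => integrable_of_continuous_volT
        (continuous_const.mul (continuous_expChar _))
  rw [integral_finsetSum _ fun m _ => integrable_finsetSum _ fun m' _ => hint m m']
  refine Finset.sum_congr rfl fun m hm => ?_
  rw [integral_finsetSum _ fun m' _ => hint m m', Finset.sum_eq_single m]
  · rw [integral_const_mul, integral_expChar]; simp
  · intro m' _ hne
    rw [integral_const_mul, integral_expChar, if_neg (by omega), mul_zero]
  · intro h; exact absurd hm h

lemma continuous_of_ofReal_eq_sum {f : ℝ → ℝ} {s : Finset ℤ} {c : ℤ → ℂ}
    (hf : ∀ x, (f x : ℂ) = ∑ m ∈ s, c m * expChar m x) : Continuous f := by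
  have h1 : f = fun x => (∑ m ∈ s, c m * expChar m x).re := by
    ext x; rw [← hf, Complex.ofReal_re]
  rw [h1]
  exact Complex.continuous_re.comp
    (continuous_finsetSum _ fun m _ => continuous_const.mul (continuous_expChar m))

lemma periodizedCoef_eq_zero {h : ℝ → ℂ} (hh : IsBandLimitedHat h) {j : ℕ} (k : ℕ) {m : ℤ}
    (hm : 4 * 2 ^ j ≤ 3 * |m|) : periodizedCoef h j k m = 0 := by
  rw [periodizedCoef, hh.eq_zero]
  · simp
  · have hj0 : (0 : ℝ) < 2 ^ j := by positivity
    have : (4 * 2 ^ j : ℝ) ≤ 3 * |(m : ℝ)| := by exact_mod_cast hm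
    rw [abs_div, abs_of_pos hj0, le_div_iff₀ hj0]
    linarith

/-- A common frequency window for functions of different levels, as Parseval's identity requires. -/
lemma ofReal_periodized_eq_sum_of_le {h : ℝ → ℂ} (hh : IsBandLimitedHat h) {j j' : ℕ}
    (hj : j ≤ j') (k : ℕ) (x : ℝ) :
    (periodized (fun x => (𝓕⁻ h x).re) j k x : ℂ) =
      ∑ m ∈ Finset.Ico (-(2 * 2 ^ j') : ℤ) (2 * 2 ^ j'), periodizedCoef h j k m * expChar m x := by
  rw [ofReal_periodized_eq_sum hh]
  have h1 : (2 : ℤ) ^ j ≤ 2 ^ j' := pow_le_pow_right₀ (by norm_num) hj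
  have h2 : (0 : ℤ) < 2 ^ j := by positivity
  refine Finset.sum_subset (Finset.Ico_subset_Ico (by linarith) (by linarith)) fun m _ hm => ?_
  rw [periodizedCoef_eq_zero hh, zero_mul]
  rw [Finset.mem_Ico, not_and_or] at hm
  have h3 : 2 * 2 ^ j ≤ |m| := by rw [le_abs]; omega
  linarith

/-! ### Meyer wavelets as elements of `L²(T)` -/

section Meyer

variable {v : ℝ → ℝ} (hv : IsMeyerAux v)
include hv

lemma ofReal_periodized_meyerWavelet {j j' : ℕ} (hj : j ≤ j') (k : ℕ) (x : ℝ) :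
    (periodized (meyerWavelet v) j k x : ℂ) =
      ∑ m ∈ Finset.Ico (-(2 * 2 ^ j') : ℤ) (2 * 2 ^ j'),
        periodizedCoef (meyerWaveletHat v) j k m * expChar m x :=
  ofReal_periodized_eq_sum_of_le (isBandLimitedHat_meyerWaveletHat hv) hj k x

lemma ofReal_periodized_meyerScaling {j j' : ℕ} (hj : j ≤ j') (k : ℕ) (x : ℝ) :
    (periodized (meyerScaling v) j k x : ℂ) =
      ∑ m ∈ Finset.Ico (-(2 * 2 ^ j') : ℤ) (2 * 2 ^ j'),
        periodizedCoef (meyerScalingHat v) j k m * expChar m x :=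
  ofReal_periodized_eq_sum_of_le (isBandLimitedHat_meyerScalingHat hv) hj k x

lemma continuous_periodized_meyerWavelet (j k : ℕ) :
    Continuous (periodized (meyerWavelet v) j k) :=
  continuous_of_ofReal_eq_sum fun x => ofReal_periodized_meyerWavelet hv le_rfl k x

lemma continuous_periodized_meyerScaling (j k : ℕ) :
    Continuous (periodized (meyerScaling v) j k) :=
  continuous_of_ofReal_eq_sum fun x => ofReal_periodized_meyerScaling hv le_rfl k x

omit hv in
lemma memLp_of_continuous_volT {f : ℝ → ℝ} (hf : Continuous f) : MemLp f 2 volT :=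
  (memLp_two_iff_integrable_sq hf.aestronglyMeasurable).2
    (integrable_of_continuous_volT (hf.pow 2))

/-- The periodized Meyer wavelet `ψ_{jk}`, as an element of `L²(T)`. -/
def waveletL2 (j k : ℕ) : L2T :=
  (memLp_of_continuous_volT (continuous_periodized_meyerWavelet hv j k)).toLp _

lemma coeFn_waveletL2 (j k : ℕ) :
    waveletL2 hv j k =ᵐ[volT] periodized (meyerWavelet v) j k :=
  MemLp.coeFn_toLp _

omit hv in
lemma integral_sum_smul_mul {ι : Type*} [Fintype ι] (c : ι → ℝ) (w : ι → L2T) {p : ℝ → ℝ}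
    (hp : Continuous p) :
    ∫ x, (∑ i, c i • w i : L2T) x * p x ∂volT = ∑ i, c i * ∫ x, w i x * p x ∂volT := by
  have h1 : ∀ f : L2T, ∫ x, f x * p x ∂volT
      = inner ℝ ((memLp_of_continuous_volT hp).toLp p) f := by
    intro f
    rw [L2.inner_def]
    refine integral_congr_ae ?_
    filter_upwards [(memLp_of_continuous_volT hp).coeFn_toLp] with x hx
    rw [hx]; simp
  simp_rw [h1, inner_sum, inner_smul_right]

lemma waveletCoeff_sum_smul {ι : Type*} [Fintype ι] (c : ι → ℝ) (w : ι → L2T) (j k : ℕ) :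
    waveletCoeff v (∑ i, c i • w i) j k = ∑ i, c i * waveletCoeff v (w i) j k :=
  integral_sum_smul_mul c w (continuous_periodized_meyerWavelet hv j k)

lemma scalingCoeff_sum_smul {ι : Type*} [Fintype ι] (c : ι → ℝ) (w : ι → L2T) (j k : ℕ) :
    scalingCoeff v (∑ i, c i • w i) j k = ∑ i, c i * scalingCoeff v (w i) j k :=
  integral_sum_smul_mul c w (continuous_periodized_meyerScaling hv j k)

lemma waveletCoeff_waveletL2 (j k j' k' : ℕ) :
    waveletCoeff v (waveletL2 hv j k) j' k'
      = ∫ x, periodized (meyerWavelet v) j k x * periodized (meyerWavelet v) j' k' x ∂volT := by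
  refine integral_congr_ae ?_
  filter_upwards [coeFn_waveletL2 hv j k] with x hx
  rw [hx]

lemma waveletCoeff_waveletL2_comm (j k j' k' : ℕ) :
    waveletCoeff v (waveletL2 hv j k) j' k' = waveletCoeff v (waveletL2 hv j' k') j k := by
  rw [waveletCoeff_waveletL2, waveletCoeff_waveletL2]
  simp_rw [mul_comm]

lemma waveletCoeff_waveletL2_same (j : ℕ) {k k' : ℕ} (hk : k < 2 ^ j) (hk' : k' < 2 ^ j) :
    waveletCoeff v (waveletL2 hv j k) j k' = if k = k' then 1 else 0 := by
  have h := integral_mul_eq_sum (ofReal_periodized_meyerWavelet hv (le_refl j) k)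
    (ofReal_periodized_meyerWavelet hv (le_refl j) k')
  rw [sum_waveletCoef_mul_conj_same hv j hk hk'] at h
  rw [waveletCoeff_waveletL2]
  split_ifs with hkk
  · rw [if_pos hkk] at h; exact_mod_cast h
  · rw [if_neg hkk] at h; exact_mod_cast h

lemma waveletCoeff_waveletL2_of_lt {j j' : ℕ} (hj : j < j') (k k' : ℕ) :
    waveletCoeff v (waveletL2 hv j' k') j k = 0 := by
  rw [waveletCoeff_waveletL2]
  have h := integral_mul_eq_sum (ofReal_periodized_meyerWavelet hv (le_refl j') k')
    (ofReal_periodized_meyerWavelet hv hj.le k)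
  have h0 : ∑ m ∈ Finset.Ico (-(2 * 2 ^ j') : ℤ) (2 * 2 ^ j'),
      periodizedCoef (meyerWaveletHat v) j' k' m *
        (starRingEnd ℂ) (periodizedCoef (meyerWaveletHat v) j k m) = 0 := by
    rcases Nat.lt_or_ge j' (j + 2) with h2 | h2
    · obtain rfl : j' = j + 1 := by omega
      exact sum_waveletCoef_mul_conj_succ hv j k' k
    · exact Finset.sum_eq_zero fun m _ => waveletCoef_mul_conj_eq_zero hv h2 k k' m
  rw [h0] at h
  exact_mod_cast h

lemma waveletCoeff_waveletL2_of_ne {j j' : ℕ} (hj : j ≠ j') (k k' : ℕ) :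
    waveletCoeff v (waveletL2 hv j k) j' k' = 0 := by
  rcases lt_or_gt_of_ne hj with h | h
  · rw [waveletCoeff_waveletL2_comm, waveletCoeff_waveletL2_of_lt hv h]
  · rw [waveletCoeff_waveletL2_of_lt hv h]

lemma scalingCoeff_waveletL2 {j j' : ℕ} (hj : j ≤ j') (k k' : ℕ) :
    scalingCoeff v (waveletL2 hv j' k') j k = 0 := by
  have h1 : scalingCoeff v (waveletL2 hv j' k') j k
      = ∫ x, periodized (meyerWavelet v) j' k' x * periodized (meyerScaling v) j k x ∂volT := by
    refine integral_congr_ae ?_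
    filter_upwards [coeFn_waveletL2 hv j' k'] with x hx
    rw [hx]
  rw [h1]
  have h := integral_mul_eq_sum (ofReal_periodized_meyerWavelet hv (le_refl j') k')
    (ofReal_periodized_meyerScaling hv hj k)
  have h0 : ∑ m ∈ Finset.Ico (-(2 * 2 ^ j') : ℤ) (2 * 2 ^ j'),
      periodizedCoef (meyerWaveletHat v) j' k' m *
        (starRingEnd ℂ) (periodizedCoef (meyerScalingHat v) j k m) = 0 := by
    rcases hj.eq_or_lt with rfl | h2
    · exact sum_waveletCoef_mul_conj_scalingCoef hv j k' k
    · exact Finset.sum_eq_zero fun m _ =>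
        waveletCoef_mul_conj_scalingCoef_eq_zero hv h2 k k' m
  rw [h0] at h
  exact_mod_cast h

lemma orthonormal_waveletL2 (j : ℕ) :
    Orthonormal ℝ fun k : Fin (2 ^ j) => waveletL2 hv j k := by
  rw [orthonormal_iff_ite]
  intro k k'
  have h1 : inner ℝ (waveletL2 hv j k) (waveletL2 hv j k')
      = waveletCoeff v (waveletL2 hv j k) j k' := by
    rw [L2.inner_def]
    refine integral_congr_ae ?_
    filter_upwards [coeFn_waveletL2 hv j k'] with x hx
    rw [hx]; simp [mul_comm]
  rw [h1, waveletCoeff_waveletL2_same hv j k.2 k'.2]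
  simp [Fin.ext_iff]

/-! ### Wavelet sums of one resolution level in Besov balls -/

omit hv in
lemma ellNorm_eq_of_forall_ne {ι : Type} {p : ℝ≥0∞} (hp : 1 ≤ p) {c : ι → ℝ≥0∞} (i : ι)
    (hc : ∀ i', i' ≠ i → c i' = 0) : ellNorm p c = c i := by
  unfold ellNorm
  split_ifs with h
  · refine le_antisymm (iSup_le fun i' => ?_) (le_iSup c i)
    by_cases h' : i' = i
    · rw [h']
    · rw [hc i' h']; exact zero_le
  · have hp0 : 0 < p.toReal := ENNReal.toReal_pos (by positivity) h
    rw [tsum_eq_single i fun i' hi' => by rw [hc i' hi', ENNReal.zero_rpow_of_pos hp0],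
      ← ENNReal.rpow_mul, mul_one_div_cancel hp0.ne', ENNReal.rpow_one]

omit hv in
lemma ellNorm_const {n : ℕ} (hn : 0 < n) {p : ℝ≥0∞} (hp : 1 ≤ p) (x : ℝ≥0∞) :
    ellNorm p (fun _ : Fin n => x) = (n : ℝ≥0∞) ^ (p⁻¹).toReal * x := by
  have : Nonempty (Fin n) := ⟨⟨0, hn⟩⟩
  unfold ellNorm
  split_ifs with h
  · simp [h]
  · have hp0 : 0 < p.toReal := ENNReal.toReal_pos (by positivity) h
    rw [tsum_fintype, Finset.sum_const, Finset.card_univ, Fintype.card_fin, nsmul_eq_mul,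
      ENNReal.mul_rpow_of_nonneg _ _ (by positivity), ← ENNReal.rpow_mul,
      mul_one_div_cancel hp0.ne', ENNReal.rpow_one, ENNReal.toReal_inv, one_div]

omit hv in
lemma ellNorm_zero {ι : Type} [Nonempty ι] {p : ℝ≥0∞} (hp : 1 ≤ p) :
    ellNorm p (fun _ : ι => 0) = 0 :=
  ellNorm_eq_of_forall_ne hp (Classical.arbitrary ι) fun _ _ => rfl

/-- By orthogonality only level `j` contributes to the Besov norm, and its coefficients are the
given ones. -/
lemma sum_smul_waveletL2_mem_besovBall {j₀ j : ℕ} (hj : j₀ ≤ j) {s A : ℝ} {p q : ℝ≥0∞}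
    (hp : 1 ≤ p) (hq : 1 ≤ q) {c : Fin (2 ^ j) → ℝ}
    (hc : ENNReal.ofReal ((2 : ℝ) ^ ((j : ℝ) * sPrime s p)) * ellNorm p (fun k => ‖c k‖ₑ)
      ≤ ENNReal.ofReal A) :
    ∑ k, c k • waveletL2 hv j k ∈ besovBall v j₀ s p q A := by
  have hne : ∀ i : ℕ, Nonempty (Fin (2 ^ i)) := fun i => ⟨⟨0, by positivity⟩⟩
  have h1 : ∀ k : ℕ, scalingCoeff v (∑ k, c k • waveletL2 hv j k) j₀ k = 0 := by
    intro k
    rw [scalingCoeff_sum_smul hv]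
    exact Finset.sum_eq_zero fun k' _ => by rw [scalingCoeff_waveletL2 hv hj, mul_zero]
  have h2 : ∀ j' k : ℕ, j' ≠ j → waveletCoeff v (∑ k, c k • waveletL2 hv j k) j' k = 0 := by
    intro j' k hne
    rw [waveletCoeff_sum_smul hv]
    exact Finset.sum_eq_zero fun k' _ => by
      rw [waveletCoeff_waveletL2_of_ne hv hne.symm, mul_zero]
  have h3 : ∀ k : Fin (2 ^ j), waveletCoeff v (∑ k, c k • waveletL2 hv j k) j k = c k := by
    intro k
    rw [waveletCoeff_sum_smul hv, Finset.sum_eq_single k]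
    · rw [waveletCoeff_waveletL2_same hv j k.2 k.2, if_pos rfl, mul_one]
    · intro k' _ hk'
      rw [waveletCoeff_waveletL2_same hv j k'.2 k.2, if_neg (by simpa [Fin.ext_iff] using hk'),
        mul_zero]
    · simp
  simp only [besovBall, Set.mem_ofPred_eq]
  rw [ellNorm_eq_of_forall_ne hq (⟨j, hj⟩ : {j : ℕ // j₀ ≤ j})]
  · simp only [h1, h3, enorm_zero, ellNorm_zero hp, zero_add]
    exact hc
  · rintro ⟨j', hj'⟩ hne'
    have h4 : j' ≠ j := fun h => hne' (by simp [h])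
    simp only [h2 j' _ h4, enorm_zero, ellNorm_zero hp, mul_zero]

end Meyer

end MultichannelDeconvolution

end

noncomputable section

namespace MultichannelDeconvolution

/-! ### The blurring operator on wavelets -/

lemma intervalIntegrable_comp_sub {gu : ℝ → ℝ} (hper : Function.Periodic gu 1)
    (hint : Integrable gu volT) (t : ℝ) : IntervalIntegrable (fun x => gu (t - x)) volume 0 1 := by
  have h1 : IntervalIntegrable gu volume 0 1 := (integrable_volT_iff gu).1 hint
  have h2 : IntervalIntegrable gu volume (t - 0) (t - 1) :=
    hper.intervalIntegrable₀ one_ne_zero h1 _ _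
  simpa using h2.comp_sub_left t

lemma integrable_comp_sub_mul {gu : ℝ → ℝ} (hper : Function.Periodic gu 1)
    (hint : Integrable gu volT) (t : ℝ) {p : ℝ → ℝ} (hp : Continuous p) :
    Integrable (fun x => gu (t - x) * p x) volT :=
  (integrable_volT_iff _).2 ((intervalIntegrable_comp_sub hper hint t).mul_continuousOn
    hp.continuousOn)

/-- Characters are eigenfunctions of periodic convolution. -/
lemma integral_comp_sub_mul_expChar {gu : ℝ → ℝ} (hper : Function.Periodic gu 1) (t : ℝ) (m : ℤ) :
    ∫ x, (gu (t - x) : ℂ) * expChar m x ∂volT = fourierCoefT gu m * expChar m t := by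
  have hper' : Function.Periodic (fun y => (gu y : ℂ) * expChar (-m) y) 1 := by
    intro y
    have h1 : expChar (-m) (y + 1) = expChar (-m) y := by
      rw [expChar, expChar, show (2 * Real.pi * (-m : ℤ) * ((y + 1 : ℝ) : ℂ) * Complex.I : ℂ)
        = 2 * Real.pi * (-m : ℤ) * y * Complex.I + (-m : ℤ) * (2 * Real.pi * Complex.I) by
          push_cast; ring, Complex.exp_add, Complex.exp_int_mul_two_pi_mul_I, mul_one]
    simp only [hper y, h1]
  have h1 : ∀ x, (gu (t - x) : ℂ) * expChar m x
      = expChar m t * ((gu (t - x) : ℂ) * expChar (-m) (t - x)) := by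
    intro x
    have : expChar m x = expChar m t * expChar (-m) (t - x) := by
      rw [expChar, expChar, expChar, ← Complex.exp_add]
      congr 1; push_cast; ring
    rw [this]; ring
  simp_rw [h1]
  rw [integral_const_mul, integral_volT_eq_intervalIntegral,
    intervalIntegral.integral_comp_sub_left (fun y => (gu y : ℂ) * expChar (-m) y) t, sub_zero]
  have h2 := hper'.intervalIntegral_add_eq (t - 1) 0
  rw [sub_add_cancel, zero_add] at h2
  rw [h2, mul_comm, fourierCoefT, integral_volT_eq_intervalIntegral]
  congr 2
  ext x
  rw [expChar]
  congr 2; push_cast; ring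

lemma coeFn_sum_smul {ι : Type*} [Fintype ι] (c : ι → ℝ) (w : ι → L2T) :
    (∑ i, c i • w i : L2T) =ᵐ[volT] fun x => ∑ i, c i * w i x := by
  filter_upwards [Lp.coeFn_finsetSum Finset.univ fun i => c i • w i,
    ae_all_iff.2 fun i => Lp.coeFn_smul (c i) (w i)] with x h1 h2
  rw [h1]
  simp [h2]

section Meyer

variable {v : ℝ → ℝ} (hv : IsMeyerAux v)

lemma blurred_waveletL2_eq_integral (gu : ℝ → ℝ) (j k : ℕ) (t : ℝ) :
    blurred gu (waveletL2 hv j k) t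
      = ∫ x, gu (t - x) * periodized (meyerWavelet v) j k x ∂volT := by
  refine integral_congr_ae ?_
  filter_upwards [coeFn_waveletL2 hv j k] with x hx
  rw [hx]

/-- For a merely integrable kernel the integral in `blurred` may fail to exist and take its default
value 0. Continuity of the wavelets ensures integrability of each term, which linearity needs. -/
lemma blurred_sum_smul_waveletL2 {gu : ℝ → ℝ} (hper : Function.Periodic gu 1)
    (hint : Integrable gu volT) (j : ℕ) (c : Fin (2 ^ j) → ℝ) (t : ℝ) :
    blurred gu (∑ k, c k • waveletL2 hv j k) t = ∑ k, c k * blurred gu (waveletL2 hv j k) t := by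
  simp_rw [blurred_waveletL2_eq_integral, ← integral_const_mul]
  rw [← integral_finsetSum _ fun (k : Fin (2 ^ j)) _ => (integrable_comp_sub_mul hper hint t
    (continuous_periodized_meyerWavelet hv j k)).const_mul _]
  refine integral_congr_ae ?_
  filter_upwards [coeFn_sum_smul c fun k : Fin (2 ^ j) => waveletL2 hv j k,
    ae_all_iff.2 fun k : Fin (2 ^ j) => coeFn_waveletL2 hv j k] with x h1 h2
  rw [h1, Finset.mul_sum]
  refine Finset.sum_congr rfl fun k _ => ?_
  rw [h2]; ring

/-- The frequencies of the Meyer wavelets of resolution level `j`. -/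
def meyerBand (j : ℕ) : Finset ℤ :=
  (Finset.Ico (-(2 * 2 ^ j) : ℤ) (2 * 2 ^ j)).filter fun m => 2 ^ j < 3 * |m| ∧ 3 * |m| < 4 * 2 ^ j

include hv in
lemma waveletCoef_eq_zero_of_notMem_meyerBand {j : ℕ} (k : ℕ) {m : ℤ}
    (hm : m ∈ Finset.Ico (-(2 * 2 ^ j) : ℤ) (2 * 2 ^ j)) (hm' : m ∉ meyerBand j) :
    periodizedCoef (meyerWaveletHat v) j k m = 0 := by
  rw [meyerBand, Finset.mem_filter, not_and, not_and_or, not_lt, not_lt] at hm'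
  rcases hm' hm with h | h
  · have hj0 : (0 : ℝ) < 2 ^ j := by positivity
    have h' : (3 * |(m : ℝ)|) ≤ 2 ^ j := by exact_mod_cast h
    rw [periodizedCoef, meyerWaveletHat_eq_zero hv (Or.inl ?_)]
    · simp
    · rw [abs_div, abs_of_pos hj0, div_le_iff₀ hj0]; linarith
  · exact periodizedCoef_eq_zero (isBandLimitedHat_meyerWaveletHat hv) k h

lemma ofReal_blurred_waveletL2 {gu : ℝ → ℝ} (hper : Function.Periodic gu 1)
    (hint : Integrable gu volT) (j k : ℕ) (t : ℝ) :
    (blurred gu (waveletL2 hv j k) t : ℂ) = ∑ m ∈ meyerBand j,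
      periodizedCoef (meyerWaveletHat v) j k m * (fourierCoefT gu m * expChar m t) := by
  rw [blurred_waveletL2_eq_integral, ← integral_complex_ofReal]
  have h1 : ∀ x, ((gu (t - x) * periodized (meyerWavelet v) j k x : ℝ) : ℂ)
      = ∑ m ∈ meyerBand j, periodizedCoef (meyerWaveletHat v) j k m *
        ((gu (t - x) : ℂ) * expChar m x) := by
    intro x
    rw [Complex.ofReal_mul, ofReal_periodized_meyerWavelet hv le_rfl, Finset.mul_sum,
      ← Finset.sum_subset (Finset.filter_subset _ _ : meyerBand j ⊆ _)]
    · refine Finset.sum_congr rfl fun m _ => by ring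
    · intro m hm hm'
      rw [waveletCoef_eq_zero_of_notMem_meyerBand hv k hm hm']
      simp
  simp_rw [h1]
  rw [integral_finsetSum]
  · refine Finset.sum_congr rfl fun m _ => ?_
    rw [integral_const_mul, integral_comp_sub_mul_expChar hper]
  · intro m _
    refine Integrable.const_mul ?_ _
    refine (integrable_volT_iff _).2 ?_
    have h2 : IntervalIntegrable (fun x => (gu (t - x) : ℂ)) volume 0 1 := by
      rw [← integrable_volT_iff]
      exact ((integrable_volT_iff _).2 (intervalIntegrable_comp_sub hper hint t)).ofReal
    exact h2.mul_continuousOn (continuous_expChar m).continuousOn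

/-- Bessel's inequality for the vector of the g_m e^{2πimt}: its inner products with the orthonormal
vectors of conjugated wavelet coefficients are the blurred wavelets at `t`. -/
lemma sum_sq_blurred_waveletL2_le {gu : ℝ → ℝ} (hper : Function.Periodic gu 1)
    (hint : Integrable gu volT) (j : ℕ) (t : ℝ) :
    ∑ k : Fin (2 ^ j), blurred gu (waveletL2 hv j k) t ^ 2
      ≤ ∑ m ∈ meyerBand j, ‖fourierCoefT gu m‖ ^ 2 := by
  let V : Fin (2 ^ j) → EuclideanSpace ℂ (meyerBand j) := fun k =>
    WithLp.toLp 2 fun m => (starRingEnd ℂ) (periodizedCoef (meyerWaveletHat v) j k m)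
  let X : EuclideanSpace ℂ (meyerBand j) :=
    WithLp.toLp 2 fun m => fourierCoefT gu m * expChar m t
  have hV : Orthonormal ℂ V := by
    rw [orthonormal_iff_ite]
    intro k k'
    have h1 := sum_waveletCoef_mul_conj_same hv j k.2 k'.2
    rw [← Finset.sum_subset (Finset.filter_subset _ _ : meyerBand j ⊆ _)] at h1
    · rw [← Finset.sum_coe_sort] at h1
      rw [EuclideanSpace.inner_eq_star_dotProduct]
      simp only [dotProduct, V, Pi.star_apply, RCLike.star_def, Complex.conj_conj]
      simp only [Fin.ext_iff]
      rw [← h1]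
      exact Finset.sum_congr rfl fun m _ => mul_comm _ _
    · intro m hm hm'
      rw [waveletCoef_eq_zero_of_notMem_meyerBand hv k hm hm', zero_mul]
  have h2 := hV.sum_inner_products_le X (s := Finset.univ)
  have h3 : ∀ k : Fin (2 ^ j), ‖inner ℂ (V k) X‖ ^ 2 = blurred gu (waveletL2 hv j k) t ^ 2 := by
    intro k
    have : inner ℂ (V k) X = (blurred gu (waveletL2 hv j k) t : ℂ) := by
      rw [ofReal_blurred_waveletL2 hv hper hint, ← Finset.sum_coe_sort,
        EuclideanSpace.inner_eq_star_dotProduct]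
      simp only [dotProduct, V, X, Pi.star_apply, RCLike.star_def, Complex.conj_conj]
      exact Finset.sum_congr rfl fun m _ => mul_comm _ _
    rw [this, Complex.norm_real, Real.norm_eq_abs, sq_abs]
  simp_rw [h3] at h2
  refine h2.trans (le_of_eq ?_)
  rw [EuclideanSpace.norm_sq_eq, ← Finset.sum_coe_sort (meyerBand j)]
  refine Finset.sum_congr rfl fun m _ => ?_
  simp [X, norm_expChar]

/-- The noise-weighted energy of the blurred wavelet `ψ_{jk}` at the design points. -/
def waveletEnergy (g : ℝ → ℝ → ℝ) {M : ℕ} (N : ℕ) (u d : Fin M → ℝ) (j k : ℕ) : ℝ :=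
  ∑ l, (N : ℝ) ^ (-2 * d l) * ‖blurredVec (g (u l)) (waveletL2 hv j k) N‖ ^ 2

lemma waveletEnergy_nonneg (g : ℝ → ℝ → ℝ) {M : ℕ} (N : ℕ) (u d : Fin M → ℝ) (j k : ℕ) :
    0 ≤ waveletEnergy hv g N u d j k :=
  Finset.sum_nonneg fun l _ => by positivity

/-- The pointwise Bessel bound does not depend on the design point, so the `N` points contribute a
factor `N`, and the weighted sum over channels is `M` times the average `tau1`. -/
lemma sum_waveletEnergy_le {g : ℝ → ℝ → ℝ} {M : ℕ} (N : ℕ) {u : Fin M → ℝ} (d : Fin M → ℝ)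
    (hper : ∀ l, Function.Periodic (g (u l)) 1) (hint : ∀ l, Integrable (g (u l)) volT) (j : ℕ) :
    ∑ k : Fin (2 ^ j), waveletEnergy hv g N u d j k
      ≤ ((N * M : ℕ) : ℝ) * ∑ m ∈ meyerBand j, tau1 g N u d m := by
  have h1 : ∀ l, ∑ k : Fin (2 ^ j), ‖blurredVec (g (u l)) (waveletL2 hv j k) N‖ ^ 2
      ≤ N * ∑ m ∈ meyerBand j, ‖fourierCoefT (g (u l)) m‖ ^ 2 := by
    intro l
    simp_rw [EuclideanSpace.real_norm_sq_eq, blurredVec]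
    rw [Finset.sum_comm]
    refine (Finset.sum_le_sum fun i _ =>
      sum_sq_blurred_waveletL2_le hv (hper l) (hint l) j _).trans (le_of_eq ?_)
    simp
  simp only [waveletEnergy]
  rw [Finset.sum_comm]
  simp_rw [← Finset.mul_sum]
  calc _ ≤ ∑ l, (N : ℝ) ^ (-2 * d l) * (N * ∑ m ∈ meyerBand j, ‖fourierCoefT (g (u l)) m‖ ^ 2) :=
        Finset.sum_le_sum fun l _ => mul_le_mul_of_nonneg_left (h1 l) (by positivity)
    _ = _ := by
        rcases Nat.eq_zero_or_pos M with rfl | hM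
        · simp
        have hM' : (M : ℝ) ≠ 0 := by positivity
        simp only [tau1]
        rw [← Finset.mul_sum, Finset.sum_comm, Nat.cast_mul, mul_assoc, ← mul_assoc (M : ℝ),
          mul_inv_cancel₀ hM', one_mul, Finset.mul_sum]
        refine Finset.sum_congr rfl fun l _ => ?_
        rw [← Finset.mul_sum]; ring

/-! ### The laws of the observations for wavelet sums -/

lemma blurredVec_sub_eq {gu : ℝ → ℝ} (hper : Function.Periodic gu 1)
    (hint : Integrable gu volT) (N j : ℕ) {c c' : Fin (2 ^ j) → ℝ} {k : Fin (2 ^ j)} {x : ℝ}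
    (hc : c' - c = Pi.single k x) :
    blurredVec gu (∑ k, c' k • waveletL2 hv j k) N - blurredVec gu (∑ k, c k • waveletL2 hv j k) N
      = x • blurredVec gu (waveletL2 hv j k) N := by
  ext i
  simp only [blurredVec, PiLp.sub_apply, PiLp.smul_apply, smul_eq_mul,
    blurred_sum_smul_waveletL2 hv hper hint, ← Finset.sum_sub_distrib, ← sub_mul]
  have h1 : ∀ k', c' k' - c k' = (Pi.single k x : Fin (2 ^ j) → ℝ) k' := fun k' => by rw [← hc]; rfl
  simp_rw [h1]
  rw [Finset.sum_eq_single k]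
  · simp
  · intro k' _ hk'; simp [hk']
  · simp

instance isProbabilityMeasure_obsLaw (g : ℝ → ℝ → ℝ) {M N : ℕ} (u : Fin M → ℝ)
    (S : Fin M → Matrix (Fin N) (Fin N) ℝ) (f : L2T) : IsProbabilityMeasure (obsLaw g u S f) := by
  unfold obsLaw; infer_instance

/-- Changing one coefficient by `x` moves the mean of every channel by `x` times the blurred
wavelet; the weights in `waveletEnergy` come from the inverse of the lower eigenvalue bound. -/
lemma hasDensitySqLE_obsLaw {g : ℝ → ℝ → ℝ} {M N : ℕ} (hN : 0 < N) {u d : Fin M → ℝ}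
    {S : Fin M → Matrix (Fin N) (Fin N) ℝ} (hS : ∀ l, (S l).PosSemidef)
    {K₁ : ℝ} (hK₁ : 0 < K₁)
    (hSK : ∀ l i, K₁ * (N : ℝ) ^ (2 * d l) ≤ (hS l).isHermitian.eigenvalues i)
    (hper : ∀ l, Function.Periodic (g (u l)) 1) (hint : ∀ l, Integrable (g (u l)) volT)
    (j : ℕ) {c c' : Fin (2 ^ j) → ℝ} {k : Fin (2 ^ j)} {x : ℝ} (hc : c' - c = Pi.single k x) :
    HasDensitySqLE (obsLaw g u S (∑ k, c k • waveletL2 hv j k))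
      (obsLaw g u S (∑ k, c' k • waveletL2 hv j k))
      (ENNReal.ofReal (Real.exp (x ^ 2 / K₁ * waveletEnergy hv g N u d j k))) := by
  have hN' : (0 : ℝ) < N := by exact_mod_cast hN
  refine (hasDensitySqLE_pi_multivariateGaussian hS (fun l => by positivity) hSK _ _).mono
    (le_of_eq ?_)
  congr 2
  rw [waveletEnergy, Finset.mul_sum]
  refine Finset.sum_congr rfl fun l _ => ?_
  rw [blurredVec_sub_eq hv (hper l) (hint l) N j hc, norm_smul, mul_pow, Real.norm_eq_abs, sq_abs,
    neg_mul, Real.rpow_neg hN'.le]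
  field_simp

end Meyer

end MultichannelDeconvolution

end

noncomputable section

namespace MultichannelDeconvolution

/-! ### Lower bounds for the minimax risk from one resolution level -/

lemma le_minimaxRisk {g : ℝ → ℝ → ℝ} {M N : ℕ} {u : Fin M → ℝ}
    {S : Fin M → Matrix (Fin N) (Fin N) ℝ} {V : Set L2T} {R : ℝ≥0∞}
    (h : ∀ est : Obs M N → L2T, StronglyMeasurable est →
      ∃ f ∈ V, R ≤ ∫⁻ y, ‖est y - f‖ₑ ^ 2 ∂(obsLaw g u S f)) :
    R ≤ minimaxRisk g u S V := by
  refine le_iInf₂ fun est hest => ?_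
  obtain ⟨f, hf, hR⟩ := h est hest
  exact le_iSup₂_of_le f hf hR

section Meyer

variable {v : ℝ → ℝ} (hv : IsMeyerAux v) {g : ℝ → ℝ → ℝ} {M N : ℕ} (hN : 0 < N) {u d : Fin M → ℝ}
  {S : Fin M → Matrix (Fin N) (Fin N) ℝ} (hS : ∀ l, (S l).PosSemidef) {K₁ : ℝ} (hK₁ : 0 < K₁)
  (hSK : ∀ l i, K₁ * (N : ℝ) ^ (2 * d l) ≤ (hS l).isHermitian.eigenvalues i)
  (hper : ∀ l, Function.Periodic (g (u l)) 1) (hint : ∀ l, Integrable (g (u l)) volT)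
  {j₀ j : ℕ} (hj : j₀ ≤ j) {s A : ℝ} (hA : 0 < A) {p q : ℝ≥0∞} (hp : 1 ≤ p) (hq : 1 ≤ q)
include hN hK₁ hSK hper hint hj hA hp hq

/-- The amplitude is the largest for which 2^j coefficients of equal modulus satisfy the Besov
constraint: their ℓ^p norm supplies the factor 2^(j/p), for every p. -/
lemma le_minimaxRisk_dense
    (hE : 8 * (A * (2 : ℝ) ^ (-((j : ℝ) * (s + 1 / 2)))) ^ 2 / K₁ *
      ∑ k : Fin (2 ^ j), waveletEnergy hv g N u d j k ≤ 2 ^ j) :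
    ENNReal.ofReal (A ^ 2 / 16 * (2 : ℝ) ^ (-((j : ℝ) * (2 * s)))) ≤
      minimaxRisk g u S (besovBall v j₀ s p q A) := by
  set γ := A * (2 : ℝ) ^ (-((j : ℝ) * (s + 1 / 2))) with hγ
  have hγ0 : 0 < γ := by positivity
  refine le_minimaxRisk fun est hest => ?_
  obtain ⟨θ, hθ⟩ := exists_le_lintegral_of_hypercube (orthonormal_waveletL2 hv j)
    (fun θ => obsLaw g u S (∑ k, (γ * boolSign (θ k)) • waveletL2 hv j k))
    (B := fun k => Real.exp (4 * γ ^ 2 / K₁ * waveletEnergy hv g N u d j k))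
    (fun k => Real.one_le_exp (mul_nonneg (by positivity) (waveletEnergy_nonneg hv g N u d j k)))
    (by
      intro θ k E hmeas
      have hc : (fun k' => γ * boolSign ((Function.update θ k (!θ k)) k')) -
          (fun k' => γ * boolSign (θ k')) = Pi.single k (γ * (-2 * boolSign (θ k))) := by
        ext k'
        rcases eq_or_ne k' k with rfl | hk
        · cases h : θ k' <;> simp [boolSign, h] <;> ring
        · simp [hk]
      have h1 := (hasDensitySqLE_obsLaw hv hN hS hK₁ hSK hper hint j hc).sq_measure_le hmeas
      have h2 : (γ * (-2 * boolSign (θ k))) ^ 2 = 4 * γ ^ 2 := by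
        rw [mul_pow γ, mul_pow (-2), boolSign_sq]; ring
      rwa [h2] at h1)
    hγ0.le hest
  refine ⟨_, sum_smul_waveletL2_mem_besovBall hv hj hp hq ?_, le_trans ?_ hθ⟩
  · have h1 : ∀ k, ‖γ * boolSign (θ k)‖ₑ = ENNReal.ofReal γ := by
      intro k
      rw [← ofReal_norm, norm_mul, Real.norm_of_nonneg hγ0.le]
      cases θ k <;> simp [boolSign]
    simp_rw [h1]
    rw [ellNorm_const (by positivity) hp, ← ENNReal.ofReal_natCast,
      ENNReal.ofReal_rpow_of_nonneg (by positivity) (by positivity),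
      ← ENNReal.ofReal_mul (by positivity), ← ENNReal.ofReal_mul (by positivity)]
    apply ENNReal.ofReal_le_ofReal
    rw [hγ, Nat.cast_pow, Nat.cast_ofNat, ← Real.rpow_natCast, ← Real.rpow_mul two_pos.le]
    rw [show ∀ x y z : ℝ, x * (y * (A * z)) = A * (x * y * z) by intros; ring,
      ← Real.rpow_add two_pos, ← Real.rpow_add two_pos, sPrime]
    rw [show (j : ℝ) * (s + 1 / 2 - (p⁻¹).toReal) + j * (p⁻¹).toReal + -(j * (s + 1 / 2)) = 0 by
      ring]
    simp
  · apply ENNReal.ofReal_le_ofReal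
    -- By e^(-z) ≥ 1 - z only the sum of the energies matters; `hE` says that these z average at
    -- most 1/2.
    have h1 : ∀ k : Fin (2 ^ j), (1 - 4 * γ ^ 2 / K₁ * waveletEnergy hv g N u d j k) / 8 ≤
        1 / (8 * Real.exp (4 * γ ^ 2 / K₁ * waveletEnergy hv g N u d j k)) := by
      intro k
      set z := 4 * γ ^ 2 / K₁ * waveletEnergy hv g N u d j k
      have h2 := Real.add_one_le_exp (-z)
      rw [one_div, mul_inv, ← Real.exp_neg]
      linarith
    have h2 := Finset.sum_le_sum fun k (_ : k ∈ Finset.univ) => h1 k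
    rw [← Finset.sum_div, Finset.sum_sub_distrib, ← Finset.mul_sum] at h2
    simp only [Finset.sum_const, Finset.card_univ, Fintype.card_fin, nsmul_eq_mul, mul_one,
      Nat.cast_pow, Nat.cast_ofNat] at h2
    have h3 : (2 : ℝ) ^ j / 16 ≤
        ∑ k : Fin (2 ^ j), 1 / (8 * Real.exp (4 * γ ^ 2 / K₁ * waveletEnergy hv g N u d j k)) := by
      refine le_trans ?_ h2
      have h4 : 8 * γ ^ 2 / K₁ = 2 * (4 * γ ^ 2 / K₁) := by ring
      rw [h4, mul_assoc] at hE
      linarith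
    refine le_trans (le_of_eq ?_) (mul_le_mul_of_nonneg_left h3 (sq_nonneg γ))
    rw [hγ, mul_pow, ← Real.rpow_natCast, ← Real.rpow_natCast, ← Real.rpow_natCast,
      ← Real.rpow_mul two_pos.le]
    rw [show ∀ x y z : ℝ, x * y * (z / 16) = x / 16 * (y * z) by intros; ring,
      ← Real.rpow_add two_pos]
    congr 2
    push_cast; ring

/-- A single coefficient may be as large as A 2^(-js'). The hypotheses are the spikes of moderate
energy, compared with the zero function; `hE` keeps the likelihood ratios below a quarter of their
number. -/
lemma le_minimaxRisk_sparse {T : ℝ} (hT : 0 < T)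
    (hET : ∑ k : Fin (2 ^ j), waveletEnergy hv g N u d j k ≤ T)
    (hE : Real.exp ((A * (2 : ℝ) ^ (-((j : ℝ) * sPrime s p))) ^ 2 / K₁ * (2 * T / 2 ^ j)) ≤
      2 ^ j / 8) :
    ENNReal.ofReal (A ^ 2 / 8 * (2 : ℝ) ^ (-((j : ℝ) * (2 * sPrime s p)))) ≤
      minimaxRisk g u S (besovBall v j₀ s p q A) := by
  classical
  set γ := A * (2 : ℝ) ^ (-((j : ℝ) * sPrime s p)) with hγ
  have hγ0 : 0 < γ := by positivity
  have hJ : (0 : ℝ) < 2 ^ j := by positivity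
  -- Markov's inequality: at least half of the indices have energy at most twice T/2^j.
  let good : Finset (Fin (2 ^ j)) :=
    Finset.univ.filter fun k => waveletEnergy hv g N u d j k ≤ 2 * T / 2 ^ j
  have hcard : (2 : ℝ) ^ j / 2 ≤ good.card := by
    have h1 : (good.card : ℝ) + (goodᶜ).card = 2 ^ j := by
      have := good.card_add_card_compl
      rw [Fintype.card_fin] at this
      exact_mod_cast this
    have h2 : ((goodᶜ).card : ℝ) * (2 * T / 2 ^ j) ≤ T := by
      refine le_trans ?_ hET
      refine le_trans ?_ (Finset.sum_le_sum_of_subset_of_nonneg (Finset.subset_univ goodᶜ)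
        fun k _ _ => waveletEnergy_nonneg hv g N u d j k)
      rw [← nsmul_eq_mul]
      refine Finset.card_nsmul_le_sum _ _ _ fun k hk => ?_
      simp only [good, Finset.mem_compl, Finset.mem_filter, Finset.mem_univ, true_and, not_le] at hk
      exact hk.le
    have h3 : ((goodᶜ).card : ℝ) ≤ 2 ^ j / 2 := by
      rw [mul_div_assoc', div_le_iff₀ hJ] at h2
      rw [le_div_iff₀ two_pos]
      exact le_of_mul_le_mul_right (by linarith) hT
    linarith
  have hgood : 0 < good.card := by
    have : (0 : ℝ) < good.card := lt_of_lt_of_le (by positivity) hcard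
    exact_mod_cast this
  have : Nonempty good := by
    obtain ⟨k, hk⟩ := Finset.card_pos.1 hgood
    exact ⟨⟨k, hk⟩⟩
  let f : Fin (2 ^ j) → L2T := fun k => ∑ k', (Pi.single k γ : Fin (2 ^ j) → ℝ) k' • waveletL2 hv j k'
  have hf : ∀ k, f k = γ • waveletL2 hv j k := by
    intro k
    simp only [f]
    rw [Finset.sum_eq_single k]
    · simp
    · intro k' _ hk'; simp [hk']
    · simp
  refine le_minimaxRisk fun est hest => ?_
  obtain ⟨k, hk⟩ := exists_le_lintegral_of_separated (f := fun k : good => f k) (r := γ / 2)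
    (by positivity)
    (by
      intro k k' hkk
      have horth := orthonormal_waveletL2 hv j
      have h1 : inner ℝ (waveletL2 hv j (k : Fin (2 ^ j))) (waveletL2 hv j (k' : Fin (2 ^ j))) = 0 :=
        horth.2 (fun h => hkk (Subtype.ext h))
      have h2 : ∀ k : Fin (2 ^ j), ‖waveletL2 hv j k‖ = 1 := fun k => horth.1 k
      rw [hf, hf, ← smul_sub, norm_smul, Real.norm_of_nonneg hγ0.le]
      have h3 : 1 ≤ ‖waveletL2 hv j (k : Fin (2 ^ j)) - waveletL2 hv j (k' : Fin (2 ^ j))‖ := by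
        have h4 := norm_sub_sq_real (waveletL2 hv j (k : Fin (2 ^ j)))
          (waveletL2 hv j (k' : Fin (2 ^ j)))
        rw [h1, h2, h2] at h4
        by_contra hlt
        push Not at hlt
        have := norm_nonneg (waveletL2 hv j (k : Fin (2 ^ j)) - waveletL2 hv j (k' : Fin (2 ^ j)))
        nlinarith
      nlinarith)
    -- The zero function, written as a wavelet sum to allow comparison by one coefficient.
    (obsLaw g u S (∑ k' : Fin (2 ^ j), (0 : ℝ) • waveletL2 hv j k'))
    (fun k : good => obsLaw g u S (f k))
    (B := Real.exp (γ ^ 2 / K₁ * (2 * T / 2 ^ j))) (Real.exp_pos _).le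
    (by
      rw [Fintype.card_coe]
      linarith)
    (by
      rintro ⟨k, hk⟩ E hmeas
      have hc : (Pi.single k γ : Fin (2 ^ j) → ℝ) - (fun _ => 0) = Pi.single k γ := by
        ext; simp
      refine ((hasDensitySqLE_obsLaw hv hN hS hK₁ hSK hper hint j hc).mono ?_).sq_measure_le hmeas
      apply ENNReal.ofReal_le_ofReal
      apply Real.exp_le_exp.2
      refine mul_le_mul_of_nonneg_left ?_ (by positivity)
      simpa [good] using hk)
    hest
  refine ⟨_, sum_smul_waveletL2_mem_besovBall hv hj hp hq ?_, le_trans (le_of_eq ?_) hk⟩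
  · rw [ellNorm_eq_of_forall_ne hp (k : Fin (2 ^ j)) (fun k' hk' => by simp [hk']), Pi.single_eq_same,
      Real.enorm_of_nonneg hγ0.le, ← ENNReal.ofReal_mul (by positivity)]
    apply ENNReal.ofReal_le_ofReal
    rw [hγ, mul_left_comm, ← Real.rpow_add two_pos, add_neg_cancel]
    simp
  · congr 1
    rw [hγ, div_pow, mul_pow, ← Real.rpow_natCast (_ ^ _), ← Real.rpow_mul two_pos.le]
    rw [show -((j : ℝ) * sPrime s p) * (2 : ℕ) = -(j * (2 * sPrime s p)) by push_cast; ring]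
    ring

end Meyer

end MultichannelDeconvolution

end

namespace MultichannelDeconvolution

/-! ### Bounds over a frequency band -/

/-- The sum of the two endpoint constants covers both signs of the exponent. -/
lemma rpow_le_of_mem_Icc_mul {a b x y : ℝ} (ha : 0 < a) (hy : 0 < y) (h1 : a * y ≤ x)
    (h2 : x ≤ b * y) (e : ℝ) : x ^ e ≤ (a ^ e + b ^ e) * y ^ e := by
  have hx : 0 < x := lt_of_lt_of_le (by positivity) h1
  have hb : 0 < b := pos_of_mul_pos_left (hx.trans_le h2) hy.le
  rw [add_mul, ← Real.mul_rpow ha.le hy.le, ← Real.mul_rpow hb.le hy.le]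
  rcases le_total 0 e with he | he
  · have := Real.rpow_le_rpow hx.le h2 he
    have h3 : 0 ≤ (a * y) ^ e := by positivity
    linarith
  · have := Real.rpow_le_rpow_of_nonpos (by positivity) h1 he
    have h3 : 0 ≤ (b * y) ^ e := by positivity
    linarith

lemma card_meyerBand_le (j : ℕ) : ((meyerBand j).card : ℝ) ≤ 4 * 2 ^ j := by
  have h1 : (meyerBand j).card ≤ 4 * 2 ^ j := by
    refine (Finset.card_filter_le _ _).trans (le_of_eq ?_)
    have h2 : (2 * 2 ^ j - -(2 * 2 ^ j) : ℤ) = ((4 * 2 ^ j : ℕ) : ℤ) := by push_cast; ring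
    rw [Int.card_Ico, h2, Int.toNat_natCast]
  exact_mod_cast h1

lemma exists_tauBound_le (ν lam α β : ℝ) (hα : 0 ≤ α) (hβ : 0 < β) (m₀ : ℕ) :
    ∃ C : ℝ, 0 < C ∧ ∃ j₁ : ℕ, ∀ j, j₁ ≤ j → ∀ m ∈ meyerBand j, (m₀ : ℤ) ≤ |m| ∧
      ∀ ε, 0 < ε → tauBound ε ν lam α β m ≤
        C * ε * ((2 : ℝ) ^ j) ^ (-2 * ν) * (j : ℝ) ^ (-lam) *
          Real.exp (-(α * (1 / 3) ^ β) * ((2 : ℝ) ^ j) ^ β) := by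
  have hlog : 0 < Real.log 2 := Real.log_pos one_lt_two
  -- On the band |m| lies between (1/3) 2^j and (4/3) 2^j. From j ≥ 4 on, ln|m| lies between (j/2)
  -- ln 2 and 2j ln 2, and j ≥ 3m₀ puts the band beyond m₀ because 2^j > j.
  refine ⟨((1 / 3 : ℝ) ^ (-2 * ν) + (4 / 3 : ℝ) ^ (-2 * ν)) *
    ((Real.log 2 / 2) ^ (-lam) + (2 * Real.log 2) ^ (-lam)), by positivity, max 4 (3 * m₀), ?_⟩
  intro j hj m hm
  have hj4 : 4 ≤ j := (le_max_left _ _).trans hj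
  have hjm : 3 * m₀ ≤ j := (le_max_right _ _).trans hj
  rw [meyerBand, Finset.mem_filter] at hm
  obtain ⟨-, hm1, hm2⟩ := hm
  refine ⟨?_, fun ε hε => ?_⟩
  · have h1 : (j : ℤ) < 2 ^ j := by exact_mod_cast Nat.lt_two_pow_self
    have h2 : 3 * (m₀ : ℤ) ≤ j := by exact_mod_cast hjm
    omega
  set J : ℝ := 2 ^ j with hJ
  have hJ0 : 0 < J := by positivity
  set x : ℝ := |(m : ℝ)| with hx
  have hx1 : 1 / 3 * J ≤ x := by
    have : (2 ^ j : ℝ) < 3 * |(m : ℝ)| := by exact_mod_cast hm1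
    rw [hJ, hx]; linarith
  have hx2 : x ≤ 4 / 3 * J := by
    have : 3 * |(m : ℝ)| < 4 * 2 ^ j := by exact_mod_cast hm2
    rw [hJ, hx]; linarith
  have hx0 : 0 < x := lt_of_lt_of_le (by positivity) hx1
  have hj0 : (4 : ℝ) ≤ j := by exact_mod_cast hj4
  have hlogJ : Real.log J = j * Real.log 2 := by rw [hJ, Real.log_pow]
  have hl1 : Real.log 2 / 2 * j ≤ Real.log x := by
    have h1 : Real.log (1 / 4 * J) ≤ Real.log x :=
      Real.log_le_log (by positivity) (le_trans (by linarith) hx1)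
    rw [Real.log_mul (by norm_num) hJ0.ne', hlogJ, show (1 / 4 : ℝ) = (2 ^ 2)⁻¹ by norm_num,
      Real.log_inv, Real.log_pow] at h1
    push_cast at h1
    nlinarith
  have hl2 : Real.log x ≤ 2 * Real.log 2 * j := by
    have h1 : Real.log x ≤ Real.log (2 * J) :=
      Real.log_le_log hx0 (hx2.trans (by linarith))
    rw [Real.log_mul two_ne_zero hJ0.ne', hlogJ] at h1
    nlinarith
  have e1 := rpow_le_of_mem_Icc_mul (by norm_num) hJ0 hx1 hx2 (-2 * ν)
  have e2 := rpow_le_of_mem_Icc_mul (by positivity) (by linarith) hl1 hl2 (-lam)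
  have e3 : Real.exp (-α * x ^ β) ≤ Real.exp (-(α * (1 / 3) ^ β) * J ^ β) := by
    apply Real.exp_le_exp.2
    have h1 : (1 / 3 * J) ^ β ≤ x ^ β := Real.rpow_le_rpow (by positivity) hx1 hβ.le
    rw [Real.mul_rpow (by norm_num) hJ0.le] at h1
    have := mul_le_mul_of_nonneg_left h1 hα
    linarith
  have hlx : 0 < Real.log x := lt_of_lt_of_le (by positivity) hl1
  unfold tauBound
  calc ε * x ^ (-2 * ν) * Real.log x ^ (-lam) * Real.exp (-α * x ^ β)
      ≤ ε * (((1 / 3 : ℝ) ^ (-2 * ν) + (4 / 3 : ℝ) ^ (-2 * ν)) * J ^ (-2 * ν)) *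
        (((Real.log 2 / 2) ^ (-lam) + (2 * Real.log 2) ^ (-lam)) * (j : ℝ) ^ (-lam)) *
        Real.exp (-(α * (1 / 3) ^ β) * J ^ β) := by gcongr
    _ = _ := by ring

/-! ### Choice of the resolution level -/

lemma exists_two_pow_mem {y : ℝ} (hy : 1 ≤ y) : ∃ j : ℕ, y ≤ 2 ^ j ∧ (2 : ℝ) ^ j ≤ 2 * y := by
  obtain ⟨j, h1, h2⟩ := exists_nat_pow_near hy (one_lt_two (α := ℝ))
  refine ⟨j + 1, h2.le, ?_⟩
  rw [pow_succ]; linarith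

/-- Take 2^j within a factor 2 above y^(1/D), where y is a constant times x (ln x)^(-κ). As ln y is
comparable to ln x, so is j, and j^(-κ) may be traded for (ln x)^(-κ). -/
lemma exists_level_polynomial {C D : ℝ} (hC : 0 < C) (hD : 0 < D) (κ : ℝ) (j₁ : ℕ) :
    ∃ C₂ : ℝ, 0 < C₂ ∧ ∀ᶠ x : ℝ in atTop, ∃ j : ℕ, j₁ ≤ j ∧
      C * x * ((2 : ℝ) ^ j) ^ (-D) * (j : ℝ) ^ (-κ) ≤ 1 ∧
      (2 : ℝ) ^ j ≤ C₂ * (x * Real.log x ^ (-κ)) ^ (1 / D) := by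
  have hlog : 0 < Real.log 2 := Real.log_pos one_lt_two
  set a : ℝ := 1 / (2 * D * Real.log 2) with ha
  set b : ℝ := 2 / (D * Real.log 2) + 1 with hb
  have ha0 : 0 < a := by positivity
  have hb0 : 0 < b := by positivity
  set C₀ : ℝ := C * (a ^ (-κ) + b ^ (-κ)) with hC₀
  have hC₀0 : 0 < C₀ := by positivity
  refine ⟨2 * C₀ ^ (1 / D), by positivity, ?_⟩
  have hlo : ∀ᶠ L : ℝ in atTop, |Real.log C₀ - κ * Real.log L| ≤ 1 / 2 * |L| := by
    have h1 : (fun L : ℝ => Real.log C₀ - κ * Real.log L) =o[atTop] (fun L : ℝ => L) :=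
      (Asymptotics.isLittleO_const_id_atTop _).sub (Real.isLittleO_log_id_atTop.const_mul_left κ)
    simpa [Real.norm_eq_abs] using h1.bound (by norm_num : (0 : ℝ) < 1 / 2)
  filter_upwards [Real.tendsto_log_atTop.eventually hlo, eventually_gt_atTop 0,
    Real.tendsto_log_atTop.eventually (eventually_ge_atTop 1),
    Real.tendsto_log_atTop.eventually (eventually_ge_atTop (j₁ / a))] with x h1 hx hL1 hLj
  set L := Real.log x with hL
  have hL0 : 0 < L := by linarith
  set y := C₀ * (x * L ^ (-κ)) with hy
  have hy0 : 0 < y := by positivity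
  have hlogy : Real.log y = L + (Real.log C₀ - κ * Real.log L) := by
    rw [hy, Real.log_mul hC₀0.ne' (by positivity),
      Real.log_mul hx.ne' (by positivity), Real.log_rpow hL0]
    ring
  rw [abs_of_pos hL0, abs_le] at h1
  have hly1 : L / 2 ≤ Real.log y := by linarith
  have hly2 : Real.log y ≤ 2 * L := by linarith
  have hy1 : 1 ≤ y ^ (1 / D) := by
    apply Real.one_le_rpow _ (by positivity)
    rw [← Real.log_nonneg_iff hy0]; linarith
  obtain ⟨j, hj1, hj2⟩ := exists_two_pow_mem hy1
  have hJ0 : (0 : ℝ) < 2 ^ j := by positivity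
  have hlj1 := Real.log_le_log (by positivity) hj1
  have hlj2 := Real.log_le_log hJ0 hj2
  rw [Real.log_pow, Real.log_rpow hy0] at hlj1
  rw [Real.log_pow, Real.log_mul two_ne_zero (by positivity), Real.log_rpow hy0] at hlj2
  have hja : a * L ≤ j := by
    have h2 : 1 / D * (L / 2) ≤ j * Real.log 2 :=
      (mul_le_mul_of_nonneg_left hly1 (by positivity)).trans hlj1
    have h3 : a * L * Real.log 2 = 1 / D * (L / 2) := by rw [ha]; field_simp
    exact le_of_mul_le_mul_right (h3.le.trans h2) hlog
  have hjb : (j : ℝ) ≤ b * L := by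
    have h2 : j * Real.log 2 ≤ Real.log 2 * L + 1 / D * (2 * L) := by
      have := mul_le_mul_of_nonneg_left hly2 (by positivity : 0 ≤ 1 / D)
      nlinarith
    have h3 : b * L * Real.log 2 = Real.log 2 * L + 1 / D * (2 * L) := by
      rw [hb]; field_simp; ring
    exact le_of_mul_le_mul_right (h2.trans h3.ge) hlog
  refine ⟨j, ?_, ?_, ?_⟩
  · rw [div_le_iff₀ ha0] at hLj
    have : (j₁ : ℝ) ≤ j := by linarith
    exact_mod_cast this
  · have h2 := rpow_le_of_mem_Icc_mul ha0 hL0 hja hjb (-κ)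
    have h3 : y ≤ ((2 : ℝ) ^ j) ^ D := by
      calc y = (y ^ (1 / D)) ^ D := by
            rw [← Real.rpow_mul hy0.le, one_div_mul_cancel hD.ne', Real.rpow_one]
        _ ≤ _ := Real.rpow_le_rpow (by positivity) hj1 hD.le
    rw [Real.rpow_neg hJ0.le, mul_right_comm, ← div_eq_mul_inv, div_le_one (by positivity)]
    refine le_trans ?_ h3
    rw [hy, hC₀]
    calc C * x * (j : ℝ) ^ (-κ) ≤ C * x * ((a ^ (-κ) + b ^ (-κ)) * L ^ (-κ)) := by gcongr
      _ = _ := by ring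
  · rw [hy, Real.mul_rpow hC₀0.le (by positivity)] at hj2
    linarith

/-- With 2^(jβ) ≥ (4/c) ln x, one half of the exponent outweighs `C * x`, and the other half
outweighs all powers of 2^j and j. -/
lemma exists_level_exponential {C c β : ℝ} (hC : 0 < C) (hc : 0 < c) (hβ : 0 < β) (D κ : ℝ)
    (j₁ : ℕ) :
    ∃ C₂ : ℝ, 0 < C₂ ∧ ∀ᶠ x : ℝ in atTop, ∃ j : ℕ, j₁ ≤ j ∧
      C * x * ((2 : ℝ) ^ j) ^ (-D) * (j : ℝ) ^ (-κ) * Real.exp (-c * ((2 : ℝ) ^ j) ^ β) ≤ 1 ∧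
      (2 : ℝ) ^ j ≤ C₂ * Real.log x ^ (1 / β) := by
  refine ⟨2 * (4 / c) ^ (1 / β), by positivity, ?_⟩
  have hbd : ∀ᶠ J : ℝ in atTop,
      J ^ (|D| + |κ|) * Real.exp (-(c / 2) * J ^ β) ≤ 1 := by
    have h1 := (tendsto_rpow_mul_exp_neg_mul_atTop_nhds_zero ((|D| + |κ|) / β) (c / 2)
      (by positivity)).comp (tendsto_rpow_atTop hβ)
    filter_upwards [h1.eventually (ge_mem_nhds one_pos), eventually_gt_atTop 0] with J hJ hJ0
    simp only [Function.comp] at hJ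
    rwa [← Real.rpow_mul hJ0.le, mul_div_cancel₀ _ hβ.ne'] at hJ
  obtain ⟨J₀, hJ₀⟩ := eventually_atTop.1 hbd
  have hy : Tendsto (fun x : ℝ => (4 / c * Real.log x) ^ (1 / β)) atTop atTop :=
    (tendsto_rpow_atTop (by positivity)).comp
      (Real.tendsto_log_atTop.const_mul_atTop (by positivity))
  filter_upwards [hy.eventually (eventually_ge_atTop (max J₀ (2 ^ (j₁ + 1)))),
    Real.tendsto_log_atTop.eventually (eventually_ge_atTop (max 1 (Real.log C))),
    eventually_gt_atTop 0] with x hx1 hx2 hx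
  have hL0 : 0 < Real.log x := lt_of_lt_of_le one_pos ((le_max_left _ _).trans hx2)
  set y := (4 / c * Real.log x) ^ (1 / β) with hydef
  have hyj : (2 : ℝ) ^ (j₁ + 1) ≤ y := (le_max_right _ _).trans hx1
  have hy1 : 1 ≤ y := (one_le_pow₀ one_le_two).trans hyj
  obtain ⟨j, hj1, hj2⟩ := exists_two_pow_mem hy1
  have hjj : j₁ + 1 ≤ j := (pow_le_pow_iff_right₀ (one_lt_two (α := ℝ))).1 (hyj.trans hj1)
  refine ⟨j, by omega, ?_, ?_⟩
  · set J : ℝ := 2 ^ j with hJ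
    have hJ1 : 1 ≤ J := hy1.trans hj1
    have hJ0 : 0 < J := by linarith
    have h1 := hJ₀ J (((le_max_left _ _).trans hx1).trans hj1)
    have hj0 : (1 : ℝ) ≤ j := by exact_mod_cast (by omega : 1 ≤ j)
    have hjJ : (j : ℝ) ≤ J := by
      rw [hJ]; exact_mod_cast (Nat.lt_two_pow_self).le
    have h2 : J ^ (-D) ≤ J ^ |D| := Real.rpow_le_rpow_of_exponent_le hJ1 (neg_le_abs D)
    have h3 : (j : ℝ) ^ (-κ) ≤ J ^ |κ| :=
      (Real.rpow_le_rpow_of_exponent_le hj0 (neg_le_abs κ)).trans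
        (Real.rpow_le_rpow (by linarith) hjJ (abs_nonneg _))
    have h4 : 4 / c * Real.log x ≤ J ^ β := by
      calc 4 / c * Real.log x = y ^ β := by
            rw [hydef, ← Real.rpow_mul (by positivity), one_div_mul_cancel hβ.ne', Real.rpow_one]
        _ ≤ _ := Real.rpow_le_rpow (by positivity) hj1 hβ.le
    have h5 : C * x * Real.exp (-(c / 2) * J ^ β) ≤ 1 := by
      rw [← Real.exp_log hC, ← Real.exp_log hx, ← Real.exp_add, ← Real.exp_add, Real.exp_le_one_iff]
      have h6 : c / 2 * (4 / c * Real.log x) ≤ c / 2 * J ^ β := by gcongr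
      have h7 : c / 2 * (4 / c * Real.log x) = 2 * Real.log x := by field_simp; ring
      have h8 := (le_max_right _ _).trans hx2
      linarith
    have h6 : Real.exp (-c * J ^ β) = Real.exp (-(c / 2) * J ^ β) * Real.exp (-(c / 2) * J ^ β) := by
      rw [← Real.exp_add]; congr 1; ring
    calc C * x * J ^ (-D) * (j : ℝ) ^ (-κ) * Real.exp (-c * J ^ β)
        ≤ C * x * J ^ |D| * J ^ |κ| * Real.exp (-c * J ^ β) := by gcongr
      _ = (C * x * Real.exp (-(c / 2) * J ^ β)) *
          (J ^ (|D| + |κ|) * Real.exp (-(c / 2) * J ^ β)) := by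
          rw [h6, Real.rpow_add hJ0]; ring
      _ ≤ 1 * 1 := by gcongr
      _ = 1 := one_mul 1
  · rw [hydef, Real.mul_rpow (by positivity) hL0.le] at hj2
    linarith

end MultichannelDeconvolution

/-! ### Total energy of a level and conversion of levels into rates -/

namespace MultichannelDeconvolution

/-- The band has at most 4 · 2^j frequencies, which gives the 1 in the exponent 1 - 2ν. The
constants precede the design, so they are uniform in n. -/
lemma exists_sum_waveletEnergy_le {v : ℝ → ℝ} (hv : IsMeyerAux v) (g : ℝ → ℝ → ℝ)
    {ν lam α β K₄ : ℝ} (hα : 0 ≤ α) (hβ : 0 < β) (hK₄ : 0 < K₄) (m₀ : ℕ) :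
    ∃ C : ℝ, 0 < C ∧ ∃ j₁ : ℕ, ∀ (M N : ℕ) (u d : Fin M → ℝ) (ε : ℝ), 0 < ε →
      (∀ l, Function.Periodic (g (u l)) 1) → (∀ l, Integrable (g (u l)) volT) →
      (∀ m : ℤ, (m₀ : ℤ) ≤ |m| → tau1 g N u d m ≤ K₄ * tauBound ε ν lam α β m) →
      ∀ j, j₁ ≤ j → ∑ k : Fin (2 ^ j), waveletEnergy hv g N u d j k ≤
        C * (((N * M : ℕ) : ℝ) * ε) * ((2 : ℝ) ^ j) ^ (1 - 2 * ν) * (j : ℝ) ^ (-lam) *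
          Real.exp (-(α * (1 / 3) ^ β) * ((2 : ℝ) ^ j) ^ β) := by
  obtain ⟨C, hC, j₁, hj₁⟩ := exists_tauBound_le ν lam α β hα hβ m₀
  refine ⟨4 * K₄ * C, by positivity, j₁, ?_⟩
  intro M N u d ε hε hper hint hτ j hj
  refine (sum_waveletEnergy_le hv N d hper hint j).trans ?_
  set X : ℝ := ((2 : ℝ) ^ j) ^ (-2 * ν) * (j : ℝ) ^ (-lam) *
    Real.exp (-(α * (1 / 3) ^ β) * ((2 : ℝ) ^ j) ^ β) with hX
  have hX0 : 0 ≤ X := by positivity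
  have h1 : ∀ m ∈ meyerBand j, tau1 g N u d m ≤ K₄ * (C * ε * X) := by
    intro m hm
    obtain ⟨h2, h3⟩ := hj₁ j hj m hm
    refine (hτ m h2).trans (mul_le_mul_of_nonneg_left ((h3 ε hε).trans (le_of_eq ?_)) hK₄.le)
    rw [hX]; ring
  have h2 := Finset.sum_le_card_nsmul _ _ _ h1
  rw [nsmul_eq_mul] at h2
  have h3 := mul_le_mul_of_nonneg_right (card_meyerBand_le j)
    (by positivity : 0 ≤ K₄ * (C * ε * X))
  calc ((N * M : ℕ) : ℝ) * ∑ m ∈ meyerBand j, tau1 g N u d m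
      ≤ ((N * M : ℕ) : ℝ) * (4 * 2 ^ j * (K₄ * (C * ε * X))) :=
        mul_le_mul_of_nonneg_left (h2.trans h3) (by positivity)
    _ = _ := by
        rw [hX, sub_eq_add_neg, Real.rpow_add (by positivity), Real.rpow_one, ← neg_mul]
        ring_nf

lemma ofReal_rpow_le_of_two_pow_le {c C₂ z D e : ℝ} {j : ℕ} {R : ℝ≥0∞} (hc : 0 ≤ c) (hC₂ : 0 < C₂)
    (hz : 0 < z) (he : 0 ≤ e) (hj : (2 : ℝ) ^ j ≤ C₂ * z ^ (1 / D))
    (hR : ENNReal.ofReal (c * (2 : ℝ) ^ (-((j : ℝ) * e))) ≤ R) :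
    ENNReal.ofReal (c * C₂ ^ (-e) * z ^ (-(e / D))) ≤ R := by
  refine le_trans (ENNReal.ofReal_le_ofReal ?_) hR
  rw [mul_assoc]
  refine mul_le_mul_of_nonneg_left ?_ hc
  calc C₂ ^ (-e) * z ^ (-(e / D)) = (C₂ * z ^ (1 / D)) ^ (-e) := by
        rw [Real.mul_rpow hC₂.le (by positivity), ← Real.rpow_mul hz.le]
        congr 2; ring
    _ ≤ ((2 : ℝ) ^ j) ^ (-e) :=
        Real.rpow_le_rpow_of_nonpos (by positivity) hj (by linarith)
    _ = _ := by
        rw [← Real.rpow_natCast, ← Real.rpow_mul two_pos.le]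
        congr 1; ring

/-- Since 1/4 < ln 2, the gain j (ln 2 - 1/4) absorbs 3 ln 2 from j = 6 on. -/
lemma exp_div_four_le {j : ℕ} (hj : 6 ≤ j) {x : ℝ} (hx : x ≤ j / 4) :
    Real.exp x ≤ 2 ^ j / 8 := by
  have hj' : (6 : ℝ) ≤ j := by exact_mod_cast hj
  have h1 : (2 : ℝ) ^ j / 8 = Real.exp (j * Real.log 2 - 3 * Real.log 2) := by
    rw [Real.exp_sub, ← Real.log_rpow two_pos, ← Real.log_rpow two_pos, Real.exp_log (by positivity),
      Real.exp_log (by positivity), Real.rpow_natCast]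
    norm_num
  rw [h1]
  apply Real.exp_le_exp.2
  have := Real.log_two_gt_d9
  have := Real.log_two_lt_d9
  nlinarith

lemma sStar_eq_sPrime {s : ℝ} {p : ℝ≥0∞} (hp : p ≤ 2) : sStar s p = sPrime s p := by
  rw [sStar, sPrime, min_eq_left hp]

lemma sStar_eq_self {s : ℝ} {p : ℝ≥0∞} (hp : 2 ≤ p) : sStar s p = s := by
  rw [sStar, min_eq_right hp, ENNReal.toReal_inv]
  norm_num

lemma sStar_pos {s : ℝ} {p : ℝ≥0∞} (hs : max 0 ((p⁻¹).toReal - 1 / 2) < s) : 0 < sStar s p := by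
  rcases le_total p 2 with h | h
  · rw [sStar_eq_sPrime h, sPrime]
    linarith [(le_max_right 0 ((p⁻¹).toReal - 1 / 2)).trans_lt hs]
  · rw [sStar_eq_self h]
    exact (le_max_left _ _).trans_lt hs

end MultichannelDeconvolution

/-! ### Assembly of the three rates -/

theorem theorem1
    -- the Meyer wavelet basis and the Besov ball
    (v : ℝ → ℝ) (hv : MultichannelDeconvolution.IsMeyerAux v) (j₀ : ℕ)
    (s A : ℝ) (p q : ℝ≥0∞) (hp : 1 ≤ p) (hq : 1 ≤ q)
    (hs : max 0 ((p⁻¹).toReal - 1 / 2) < s) (hA : 0 < A)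
    -- the blurring kernel, periodic and integrable in the second variable
    (a b : ℝ) (ha : 0 < a) (hab : a ≤ b) (g : ℝ → ℝ → ℝ)
    (hg_per : ∀ x ∈ Set.Icc a b, Function.Periodic (g x) 1)
    (hg_int : ∀ x ∈ Set.Icc a b, Integrable (g x) MultichannelDeconvolution.volT)
    -- the sequence of designs, with total numbers of observations tending to infinity
    (M N : ℕ → ℕ) (hn : Tendsto (fun r => N r * M r) atTop atTop)
    (u : ∀ r, Fin (M r) → ℝ) (hu : ∀ r l, u r l ∈ Set.Icc a b)
    (S : ∀ r, Fin (M r) → Matrix (Fin (N r)) (Fin (N r)) ℝ) (hS : ∀ r l, (S r l).PosSemidef)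
    -- the eigenvalues of the covariance matrices
    (d : ∀ r, Fin (M r) → ℝ) (hd : ∀ r l, 0 ≤ d r l ∧ d r l < 1 / 2)
    (K₁ K₂ : ℝ) (hK₁ : 0 < K₁) (hK₁₂ : K₁ ≤ K₂)
    (hA1 : ∀ r l i, K₁ * (N r : ℝ) ^ (2 * d r l) ≤ (hS r l).isHermitian.eigenvalues i ∧
      (hS r l).isHermitian.eigenvalues i ≤ K₂ * (N r : ℝ) ^ (2 * d r l))
    -- the two-sided bounds on `τ_1`
    (ν₁ ν₂ lam₁ lam₂ α₁ α₂ β K₃ K₄ : ℝ) (hα₁ : 0 ≤ α₁) (hα₂ : 0 ≤ α₂) (hβ : 0 < β)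
    (hK₃ : 0 < K₃) (hK₄ : 0 < K₄)
    (hcases : α₁ * α₂ ≠ 0 ∨ (α₁ = 0 ∧ α₂ = 0 ∧ ν₁ = ν₂ ∧ 0 < ν₁))
    (ε : ℕ → ℝ) (hε : ∀ r, 0 < ε r) (m₀ : ℕ) (hm₀ : 2 ≤ m₀)
    (hA2 : ∀ r, ∀ m : ℤ, (m₀ : ℤ) ≤ |m| →
      K₃ * MultichannelDeconvolution.tauBound (ε r) ν₁ lam₁ α₁ β m ≤
          MultichannelDeconvolution.tau1 g (N r) (u r) (d r) m ∧
        MultichannelDeconvolution.tau1 g (N r) (u r) (d r) m ≤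
          K₄ * MultichannelDeconvolution.tauBound (ε r) ν₂ lam₂ α₂ β m)
    (nStar : ℕ → ℝ) (hnStar : ∀ r, nStar r = ((N r * M r : ℕ) : ℝ) * ε r)
    (hnStar_lim : Tendsto nStar atTop atTop) :
    ∃ C : ℝ, 0 < C ∧
      -- regular-smooth, dense case
      (α₁ = 0 → α₂ = 0 →
        ν₁ * (2 * (p⁻¹).toReal - 1) < MultichannelDeconvolution.sStar s p →
        ∀ᶠ r in atTop,
          ENNReal.ofReal (C * nStar r ^ (-(2 * s / (2 * s + 2 * ν₁ + 1))) *
              Real.log (nStar r) ^ (2 * s * lam₂ / (2 * s + 2 * ν₁ + 1))) ≤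
            MultichannelDeconvolution.minimaxRisk g (u r) (S r)
              (MultichannelDeconvolution.besovBall v j₀ s p q A)) ∧
      -- regular-smooth, sparse case
      (α₁ = 0 → α₂ = 0 →
        MultichannelDeconvolution.sStar s p ≤ ν₁ * (2 * (p⁻¹).toReal - 1) →
        ∀ᶠ r in atTop,
          ENNReal.ofReal (C * (Real.log (nStar r) / nStar r) ^
                (2 * MultichannelDeconvolution.sStar s p /
                  (2 * MultichannelDeconvolution.sStar s p + 2 * ν₁)) *
              Real.log (nStar r) ^
                (2 * MultichannelDeconvolution.sStar s p * lam₂ /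
                  (2 * MultichannelDeconvolution.sStar s p + 2 * ν₁))) ≤
            MultichannelDeconvolution.minimaxRisk g (u r) (S r)
              (MultichannelDeconvolution.besovBall v j₀ s p q A)) ∧
      -- super-smooth case
      (α₁ * α₂ ≠ 0 →
        ∀ᶠ r in atTop,
          ENNReal.ofReal (C * Real.log (nStar r) ^
              (-(2 * MultichannelDeconvolution.sStar s p / β))) ≤
            MultichannelDeconvolution.minimaxRisk g (u r) (S r)
              (MultichannelDeconvolution.besovBall v j₀ s p q A))
    := by
  open MultichannelDeconvolution in
  have hs0 : 0 < s := (le_max_left _ _).trans_lt hs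
  have hsS : 0 < sStar s p := sStar_pos hs
  have hper : ∀ r l, Function.Periodic (g (u r l)) 1 := fun r l => hg_per _ (hu r l)
  have hint : ∀ r l, Integrable (g (u r l)) volT := fun r l => hg_int _ (hu r l)
  obtain ⟨C, hC, j₁, hE⟩ := exists_sum_waveletEnergy_le hv g (ν := ν₂) (lam := lam₂) hα₂ hβ hK₄ m₀
  replace hE : ∀ r j, j₁ ≤ j → _ := fun r => hE (M r) (N r) (u r) (d r) (ε r) (hε r) (hper r)
    (hint r) fun m hm => (hA2 r m hm).2
  simp only [← hnStar] at hE
  set c : ℝ := α₂ * (1 / 3) ^ β with hc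
  have hNpos : ∀ᶠ r in atTop, 0 < N r := by
    filter_upwards [hn.eventually (eventually_ge_atTop 1)] with r hr
    exact Nat.pos_of_mul_pos_right hr
  -- The cube condition with the energy bound inserted and divided by 2^j; the exponential factor is
  -- kept so as to serve both the regular and the super-smooth case.
  have hdense : ∀ r, 0 < N r → ∀ j, j₁ + j₀ ≤ j →
      8 * A ^ 2 * C / K₁ * nStar r * ((2 : ℝ) ^ j) ^ (-(2 * s + 2 * ν₂ + 1)) *
        (j : ℝ) ^ (-lam₂) * Real.exp (-c * ((2 : ℝ) ^ j) ^ β) ≤ 1 →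
      ENNReal.ofReal (A ^ 2 / 16 * (2 : ℝ) ^ (-((j : ℝ) * (2 * s)))) ≤
        minimaxRisk g (u r) (S r) (besovBall v j₀ s p q A) := by
    intro r hNr j hj hle
    refine le_minimaxRisk_dense hv hNr (hS r) hK₁ (fun l i => (hA1 r l i).1) (hper r) (hint r)
      (by omega) hA hp hq ?_
    have hJ : (0 : ℝ) < 2 ^ j := by positivity
    refine (mul_le_mul_of_nonneg_left (hE r j (by omega)) (by positivity)).trans ?_
    have h1 : ((2 : ℝ) ^ (-((j : ℝ) * (s + 1 / 2)))) ^ 2 = ((2 : ℝ) ^ j) ^ (-(2 * s + 1)) := by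
      rw [← Real.rpow_natCast, ← Real.rpow_natCast, ← Real.rpow_mul two_pos.le,
        ← Real.rpow_mul two_pos.le]
      congr 1; push_cast; ring
    have h2 : ((2 : ℝ) ^ j) ^ (-(2 * s + 1)) * ((2 : ℝ) ^ j) ^ (1 - 2 * ν₂)
        = ((2 : ℝ) ^ j) ^ (-(2 * s + 2 * ν₂ + 1)) * 2 ^ j := by
      rw [← Real.rpow_add hJ]
      nth_rewrite 3 [← Real.rpow_one ((2 : ℝ) ^ j)]
      rw [← Real.rpow_add hJ]
      congr 1; ring
    rw [mul_pow, h1]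
    calc _ = 8 * A ^ 2 * C / K₁ * nStar r * (((2 : ℝ) ^ j) ^ (-(2 * s + 1)) *
            ((2 : ℝ) ^ j) ^ (1 - 2 * ν₂)) * (j : ℝ) ^ (-lam₂) *
            Real.exp (-c * ((2 : ℝ) ^ j) ^ β) := by ring
      _ = (8 * A ^ 2 * C / K₁ * nStar r * ((2 : ℝ) ^ j) ^ (-(2 * s + 2 * ν₂ + 1)) *
            (j : ℝ) ^ (-lam₂) * Real.exp (-c * ((2 : ℝ) ^ j) ^ β)) * 2 ^ j := by rw [h2]; ring
      _ ≤ 1 * 2 ^ j := by gcongr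
      _ = 2 ^ j := one_mul _
  -- The spikes only need an exponent at most j/4. Dividing by j changes the power of j to -(λ₂ +
  -- 1), the source of the additional logarithm.
  have hsparse : p ≤ 2 → ∀ r, 0 < N r → 0 < nStar r → ∀ j, j₁ + j₀ + 6 ≤ j →
      8 * A ^ 2 * C / K₁ * nStar r * ((2 : ℝ) ^ j) ^ (-(2 * sStar s p + 2 * ν₂)) *
        (j : ℝ) ^ (-(lam₂ + 1)) * Real.exp (-c * ((2 : ℝ) ^ j) ^ β) ≤ 1 →
      ENNReal.ofReal (A ^ 2 / 8 * (2 : ℝ) ^ (-((j : ℝ) * (2 * sStar s p)))) ≤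
        minimaxRisk g (u r) (S r) (besovBall v j₀ s p q A) := by
    intro hp2 r hNr hnr j hj hle
    rw [sStar_eq_sPrime hp2] at hle ⊢
    have hJ : (0 : ℝ) < 2 ^ j := by positivity
    have hj0 : (0 : ℝ) < j := by exact_mod_cast (by omega : 0 < j)
    refine le_minimaxRisk_sparse hv hNr (hS r) hK₁ (fun l i => (hA1 r l i).1) (hper r) (hint r)
      (by omega) hA hp hq ?_ (hE r j (by omega)) (exp_div_four_le (by omega) ?_)
    · positivity
    have h1 : ((2 : ℝ) ^ (-((j : ℝ) * sPrime s p))) ^ 2 = ((2 : ℝ) ^ j) ^ (-(2 * sPrime s p)) := by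
      rw [← Real.rpow_natCast, ← Real.rpow_natCast, ← Real.rpow_mul two_pos.le,
        ← Real.rpow_mul two_pos.le]
      congr 1; push_cast; ring
    have h2 : ((2 : ℝ) ^ j) ^ (-(2 * sPrime s p)) * ((2 : ℝ) ^ j) ^ (1 - 2 * ν₂)
        = ((2 : ℝ) ^ j) ^ (-(2 * sPrime s p + 2 * ν₂)) * 2 ^ j := by
      rw [← Real.rpow_add hJ]
      nth_rewrite 3 [← Real.rpow_one ((2 : ℝ) ^ j)]
      rw [← Real.rpow_add hJ]
      congr 1; ring
    have h3 : (j : ℝ) ^ (-lam₂) = (j : ℝ) ^ (-(lam₂ + 1)) * j := by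
      nth_rewrite 3 [← Real.rpow_one (j : ℝ)]
      rw [← Real.rpow_add hj0]
      congr 1; ring
    rw [mul_pow, h1, h3]
    calc _ = 2 * A ^ 2 * C / K₁ * nStar r * (((2 : ℝ) ^ j) ^ (-(2 * sPrime s p)) *
            ((2 : ℝ) ^ j) ^ (1 - 2 * ν₂)) / 2 ^ j * ((j : ℝ) ^ (-(lam₂ + 1)) * j) *
            Real.exp (-c * ((2 : ℝ) ^ j) ^ β) := by ring
      _ = (8 * A ^ 2 * C / K₁ * nStar r * ((2 : ℝ) ^ j) ^ (-(2 * sPrime s p + 2 * ν₂)) *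
            (j : ℝ) ^ (-(lam₂ + 1)) * Real.exp (-c * ((2 : ℝ) ^ j) ^ β)) * (j / 4) := by
          rw [h2]; field_simp; ring
      _ ≤ 1 * (j / 4) := by gcongr
      _ = j / 4 := one_mul _
  have hC' : 0 < 8 * A ^ 2 * C / K₁ := by positivity
  have hlogpos : ∀ᶠ r in atTop, 0 < Real.log (nStar r) :=
    (Real.tendsto_log_atTop.comp hnStar_lim).eventually (eventually_gt_atTop 0)
  have hnpos := hnStar_lim.eventually (eventually_gt_atTop 0)
  rcases hcases with hα | ⟨hα1, hα2, rfl, hν⟩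
  · have hα2 : 0 < α₂ := lt_of_le_of_ne hα₂ (Ne.symm (right_ne_zero_of_mul hα))
    have hc0 : 0 < c := by positivity
    have hα1 : α₁ ≠ 0 := left_ne_zero_of_mul hα
    suffices h : ∃ C₀ : ℝ, 0 < C₀ ∧ ∀ᶠ r in atTop,
        ENNReal.ofReal (C₀ * Real.log (nStar r) ^ (-(2 * sStar s p / β))) ≤
          minimaxRisk g (u r) (S r) (besovBall v j₀ s p q A) by
      obtain ⟨C₀, h1, h2⟩ := h
      exact ⟨C₀, h1, fun h => absurd h hα1, fun h => absurd h hα1, fun _ => h2⟩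
    -- Spikes when s* = s', the cube when s* = s: either way the risk is of order 2^(-2js*), and
    -- polynomial factors are lost in the exponential.
    rcases le_total p 2 with hp2 | hp2
    · obtain ⟨C₂, hC₂, hlev⟩ := exists_level_exponential hC' hc0 hβ (2 * sStar s p + 2 * ν₂)
        (lam₂ + 1) (j₁ + j₀ + 6)
      refine ⟨A ^ 2 / 8 * C₂ ^ (-(2 * sStar s p)), by positivity, ?_⟩
      filter_upwards [hnStar_lim.eventually hlev, hNpos, hnpos, hlogpos] with r ⟨j, hj, h1, h2⟩ h3 h4 h5
      exact ofReal_rpow_le_of_two_pow_le (by positivity) hC₂ h5 (by linarith) h2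
        (hsparse hp2 r h3 h4 j hj h1)
    · obtain ⟨C₂, hC₂, hlev⟩ := exists_level_exponential hC' hc0 hβ (2 * s + 2 * ν₂ + 1)
        lam₂ (j₁ + j₀)
      rw [sStar_eq_self hp2]
      refine ⟨A ^ 2 / 16 * C₂ ^ (-(2 * s)), by positivity, ?_⟩
      filter_upwards [hnStar_lim.eventually hlev, hNpos, hlogpos] with r ⟨j, hj, h1, h2⟩ h3 h5
      exact ofReal_rpow_le_of_two_pow_le (by positivity) hC₂ h5 (by linarith) h2
        (hdense r h3 j hj h1)
  · have hc0 : c = 0 := by rw [hc, hα2, zero_mul]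
    have hsup : α₁ * α₂ = 0 := by rw [hα1, zero_mul]
    simp only [hc0, neg_zero, zero_mul, Real.exp_zero, mul_one] at hdense hsparse
    rcases lt_or_ge (ν₁ * (2 * (p⁻¹).toReal - 1)) (sStar s p) with hreg | hreg
    · obtain ⟨C₂, hC₂, hlev⟩ := exists_level_polynomial hC' (D := 2 * s + 2 * ν₁ + 1)
        (by positivity) lam₂ (j₁ + j₀)
      refine ⟨A ^ 2 / 16 * C₂ ^ (-(2 * s)), by positivity, fun _ _ _ => ?_,
        fun _ _ h => absurd hreg (not_lt.2 h), fun h => absurd hsup h⟩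
      filter_upwards [hnStar_lim.eventually hlev, hNpos, hnpos, hlogpos] with r ⟨j, hj, h1, h2⟩ h3 h4 h5
      have h6 := ofReal_rpow_le_of_two_pow_le (by positivity) hC₂ (by positivity) (by linarith) h2
        (hdense r h3 j hj h1)
      refine le_trans (le_of_eq ?_) h6
      rw [Real.mul_rpow h4.le (by positivity), ← Real.rpow_mul h5.le, ← mul_assoc]
      congr 3
      ring
    -- For p above 2 the left side s* = s is positive while ν(2/p - 1) is not.
    · have hp2 : p ≤ 2 := by
        by_contra hcon
        have hp2 : 2 ≤ p := (not_le.1 hcon).le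
        rw [sStar_eq_self hp2] at hreg
        have h1 : (p⁻¹).toReal ≤ 1 / 2 := by
          have := ENNReal.toReal_mono (by norm_num) (ENNReal.inv_le_inv.2 hp2)
          rw [ENNReal.toReal_inv 2] at this
          norm_num at this ⊢
          exact this
        nlinarith
      obtain ⟨C₂, hC₂, hlev⟩ := exists_level_polynomial hC' (D := 2 * sStar s p + 2 * ν₁)
        (by positivity) (lam₂ + 1) (j₁ + j₀ + 6)
      refine ⟨A ^ 2 / 8 * C₂ ^ (-(2 * sStar s p)), by positivity,
        fun _ _ h => absurd h (not_lt.2 hreg), fun _ _ _ => ?_, fun h => absurd hsup h⟩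
      filter_upwards [hnStar_lim.eventually hlev, hNpos, hnpos, hlogpos] with r ⟨j, hj, h1, h2⟩ h3 h4 h5
      have h6 := ofReal_rpow_le_of_two_pow_le (by positivity) hC₂ (by positivity) (by linarith) h2
        (hsparse hp2 r h3 h4 j hj h1)
      refine le_trans (le_of_eq ?_) h6
      congr 1
      set e := 2 * sStar s p / (2 * sStar s p + 2 * ν₁) with he
      rw [Real.mul_rpow h4.le (by positivity), ← Real.rpow_mul h5.le, Real.div_rpow h5.le h4.le,
        Real.rpow_neg h4.le]
      -- The 1 in λ₂ + 1 yields the logarithm inside (ln n*/n*)^e, and λ₂ the separate logarithmic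
      -- factor.
      have h7 : -(lam₂ + 1) * -e
          = e + 2 * sStar s p * lam₂ / (2 * sStar s p + 2 * ν₁) := by
        rw [he]; ring
      rw [h7, Real.rpow_add h5]
      ring
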